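/- Let $P,Q$ be real polynomials in one variable. There is $N\in\mathbb N$, depending only on $P$ and $Q$, such that the following holds for all $0<\beta<\alpha\le 1$. Functions on $\mathbb T^2=\mathbb R^2/(2\pi\mathbb Z)^2$ are identified with functions on $\mathbb R^2$ that are $2\pi$-periodic in each variable; $\|f\|_{L^1(\mathbb T^2)}=\int_{-\pi}^{\pi}\int_{-\pi}^{\pi}|f|\,dx\,dy$; $C_b(\mathbb R^2)$ is the Banach space of bounded continuous functions with the sup norm; $a^+=\max(0,a)$, $a^-=\max(0,-a)$. Let $\phi\in C_c^\infty(\mathbb R^2)$ with $\int\phi=1$, and $\phi_{h}(x,y)=h^{-2}\phi(x/h,y/h)$. For $0<\epsilon<1$ and $t\ge0$ let $u^\epsilon(\cdot,t),v^\epsilon(\cdot,t)$ be continuous functions on $\mathbb T^2$ (the velocity components, for instance approximate solutions of scalar conservation laws $\partial_tu+\partial_xf_1(u)+\partial_yf_2(u)=0$, $\partial_tv+\partial_xg_1(v)+\partial_yg_2(v)=0$), continuous in $t\in[0,\infty)$ for the sup norm, bounded uniformly in $(\epsilon,x,y,t)$, having first partial derivatives in $x$ and $y$ at every point, and such that for every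 $\delta>0$ there is a constant $c$ with $$|\partial_xu^\epsilon|,\ |\partial_yu^\epsilon|,\ |\partial_xv^\epsilon|,\ |\partial_yv^\epsilon|\ \le\ \frac{c}{\epsilon^{\beta}}\qquad\text{on }\mathbb T^2\times[0,\delta],\ 0<\epsilon<1 .$$ Let $\rho_0^\epsilon,w_0^\epsilon$ be continuous functions on $\mathbb T^2$ that are bounded in $L^1(\mathbb T^2)$ uniformly in $\epsilon\in(0,1)$. Put $$(A^\epsilon_tX)(x,y)=\tfrac1\epsilon\big[(Xu^{\epsilon+})(x-\epsilon,y)-(X|u^\epsilon|)(x,y)+(Xu^{\epsilon-})(x+\epsilon,y)+(Xv^{\epsilon+})(x,y-\epsilon)-(X|v^\epsilon|)(x,y)+(Xv^{\epsilon-})(x,y+\epsilon)\big],$$ the velocities being taken at time $t$. Then: 1. For each $\epsilon\in(0,1)$ the linear ODE $\frac{d}{dt}X^\epsilon=A^\epsilon_tX^\epsilon$, $X^\epsilon(\cdot,0)=\rho_0^\epsilon$, in $C_b(\mathbb R^2)$ has a unique solution on $[0,\infty)$. With $\rho^\epsilon(\cdot,t)=X^\epsilon(\cdot,t)*\phi_{\epsilon^\alpha}$,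 which is $C^\infty$ in $(x,y)$, the ODE $$\tfrac{d}{dt}w^\epsilon=A^\epsilon_tw^\epsilon-P'(\rho^\epsilon)\,\partial_x\rho^\epsilon-Q'(\rho^\epsilon)\,\partial_y\rho^\epsilon,\qquad w^\epsilon(\cdot,0)=w_0^\epsilon,$$ in $C_b(\mathbb R^2)$ also has a unique solution on $[0,\infty)$. Both solutions are $2\pi$-periodic in $x$ and $y$. 2. There is a constant $C$ with $\|X^\epsilon(\cdot,t)\|_{L^1(\mathbb T^2)}\le\|\rho_0^\epsilon\|_{L^1(\mathbb T^2)}\le C$ for all $t\ge0$, $0<\epsilon<1$. 3. There is a constant $M$ with $|\rho^\epsilon|\le M\epsilon^{-2\alpha}$ and $|\partial_x\rho^\epsilon|,|\partial_y\rho^\epsilon|\le M\epsilon^{-3\alpha}$ on $\mathbb T^2\times[0,\infty)$ for all $0<\epsilon<1$. 4. There is a constant $C>0$ with $\|w^\epsilon(\cdot,t)\|_{L^1(\mathbb T^2)}\le C(1+t)\,\epsilon^{-N\alpha}$ for all $t\ge0$, $0<\epsilon<1$. In particular this $L^1$ norm is $O(\epsilon^{-N\alpha})$ uniformly for $t$ in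 bounded intervals. 5. $(u^\epsilon,v^\epsilon,\rho^\epsilon)$ is a weak asymptotic method for $\partial_t\rho+\partial_x(\rho u)+\partial_y(\rho v)=0$: for all $\psi\in C_c^\infty(\mathbb R^2)$, $$\int_{\mathbb R^2}\big[\partial_t\rho^\epsilon\,\psi-u^\epsilon\rho^\epsilon\,\partial_x\psi-v^\epsilon\rho^\epsilon\,\partial_y\psi\big]dx\,dy\to0\qquad(\epsilon\to0^+),$$ uniformly for $t$ in bounded subsets of $[0,\infty)$. 6. If $N\alpha<1$, then $(u^\epsilon,v^\epsilon,\rho^\epsilon,w^\epsilon)$ is a weak asymptotic method for $\partial_tw+\partial_x(uw)+\partial_y(vw)+\partial_xP(\rho)+\partial_yQ(\rho)=0$: for all $\psi\in C_c^\infty(\mathbb R^2)$, $$\int_{\mathbb R^2}\big[\partial_tw^\epsilon\,\psi-(u^\epsilon w^\epsilon+P(\rho^\epsilon))\,\partial_x\psi-(v^\epsilon w^\epsilon+Q(\rho^\epsilon))\,\partial_y\psi\big]dx\,dy\to0\qquad(\epsilon\to0^+),$$ uniformly for $t$ in bounded subsets of $[0,\infty)$. 7. If $\rho_0^\epsilon\to\rho_0$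 in $L^1(\mathbb T^2)$ as $\epsilon\to0^+$, then $\rho^\epsilon(\cdot,0)\to\rho_0$ in the sense of distributions on $\mathbb R^2$; if $w_0^\epsilon\to w_0$ in $L^1(\mathbb T^2)$, then $w^\epsilon(\cdot,0)\to w_0$ in the sense of distributions. -/

import Mathlib

open MeasureTheory Filter Topology Set
open scoped ContDiff BoundedContinuousFunction

noncomputable section

/-- A function on the plane is `2π`-periodic in both variables, i.e. it is a function on the torus. -/
def IsTorusPeriodic (f : ℝ × ℝ → ℝ) : Prop :=
  ∀ x y : ℝ, f (x + 2 * Real.pi, y) = f (x, y) ∧ f (x, y + 2 * Real.pi) = f (x, y)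

/-- The `L¹` norm over one period: `∫_{-π}^{π} ∫_{-π}^{π} |f(x,y)| dx dy`. -/
def torusL1 (f : ℝ × ℝ → ℝ) : ℝ :=
  ∫ p in Icc (-Real.pi) Real.pi ×ˢ Icc (-Real.pi) Real.pi, |f p|

/-- Partial derivative in the first variable. -/
def partialX (f : ℝ × ℝ → ℝ) (p : ℝ × ℝ) : ℝ := deriv (fun s : ℝ => f (s, p.2)) p.1

/-- Partial derivative in the second variable. -/
def partialY (f : ℝ × ℝ → ℝ) (p : ℝ × ℝ) : ℝ := deriv (fun s : ℝ => f (p.1, s)) p.2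

/-- The family of velocity components `u ε t (x, y)`, `0 < ε < 1`, `t ≥ 0`: periodic, continuous in
time with values in the bounded continuous functions, uniformly bounded, and with first order
partial derivatives in space that are `O(ε^{-β})` uniformly on `[0, δ] × 𝕋²` for every `δ`. -/
structure IsVelocityFamily (β : ℝ) (u : ℝ → ℝ → (ℝ × ℝ →ᵇ ℝ)) : Prop where
  periodic : ∀ ε ∈ Ioo (0 : ℝ) 1, ∀ t : ℝ, 0 ≤ t → IsTorusPeriodic (u ε t)
  continuous_time : ∀ ε ∈ Ioo (0 : ℝ) 1, ContinuousOn (u ε) (Ici 0)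
  bounded : ∃ M : ℝ, ∀ ε ∈ Ioo (0 : ℝ) 1, ∀ t : ℝ, 0 ≤ t → ∀ p : ℝ × ℝ, |u ε t p| ≤ M
  differentiable : ∀ ε ∈ Ioo (0 : ℝ) 1, ∀ t : ℝ, 0 ≤ t → ∀ p : ℝ × ℝ,
    DifferentiableAt ℝ (fun s : ℝ => u ε t (s, p.2)) p.1 ∧
      DifferentiableAt ℝ (fun s : ℝ => u ε t (p.1, s)) p.2
  gradient_bound : ∀ δ : ℝ, 0 < δ → ∃ c : ℝ, ∀ ε ∈ Ioo (0 : ℝ) 1, ∀ t ∈ Icc 0 δ, ∀ p : ℝ × ℝ,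
    |partialX (u ε t) p| ≤ c / ε ^ β ∧ |partialY (u ε t) p| ≤ c / ε ^ β

/-- Regularized initial data: continuous periodic functions bounded in `L¹(𝕋²)` uniformly in `ε`. -/
structure IsInitialFamily (f : ℝ → (ℝ × ℝ →ᵇ ℝ)) : Prop where
  periodic : ∀ ε ∈ Ioo (0 : ℝ) 1, IsTorusPeriodic (f ε)
  bounded : ∃ C : ℝ, ∀ ε ∈ Ioo (0 : ℝ) 1, torusL1 (f ε) ≤ C

/-- The upwind discretization, with step `ε` and in both axis directions, of
`-∂ₓ(X u) - ∂_y(X v)`. -/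
def upwind (ε : ℝ) (u v X : ℝ × ℝ → ℝ) (p : ℝ × ℝ) : ℝ :=
  1 / ε *
    (X (p.1 - ε, p.2) * max 0 (u (p.1 - ε, p.2)) - X p * |u p|
        + X (p.1 + ε, p.2) * max 0 (-u (p.1 + ε, p.2))
      + X (p.1, p.2 - ε) * max 0 (v (p.1, p.2 - ε)) - X p * |v p|
        + X (p.1, p.2 + ε) * max 0 (-v (p.1, p.2 + ε)))

/-- `X : [0, ∞) → C_b(ℝ²)` solves the linear ODE `X' = upwind X + S`, `X(0) = X₀` in the Banach space
of bounded continuous functions with the sup norm (the derivative at `t = 0` is one-sided). Values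
of `X` at negative times are irrelevant. -/
def IsUpwindSolution (ε : ℝ) (u v : ℝ → (ℝ × ℝ →ᵇ ℝ)) (S : ℝ → ℝ × ℝ → ℝ) (X₀ : ℝ × ℝ →ᵇ ℝ)
    (X : ℝ → (ℝ × ℝ →ᵇ ℝ)) : Prop :=
  X 0 = X₀ ∧
    ∀ t : ℝ, 0 ≤ t → ∃ D : ℝ × ℝ →ᵇ ℝ,
      (∀ p : ℝ × ℝ, D p = upwind ε (u t) (v t) (X t) p + S t p) ∧
        HasDerivWithinAt X D (Ici 0) t

/-- The upwind ODE has `X` as a solution on `[0, ∞)`, and as its only one. -/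
def IsUniqueUpwindSolution (ε : ℝ) (u v : ℝ → (ℝ × ℝ →ᵇ ℝ)) (S : ℝ → ℝ × ℝ → ℝ)
    (X₀ : ℝ × ℝ →ᵇ ℝ) (X : ℝ → (ℝ × ℝ →ᵇ ℝ)) : Prop :=
  IsUpwindSolution ε u v S X₀ X ∧
    ∀ Y : ℝ → (ℝ × ℝ →ᵇ ℝ), IsUpwindSolution ε u v S X₀ Y → ∀ t : ℝ, 0 ≤ t → Y t = X t

/-- A smooth compactly supported function on the plane. -/
def IsTestFunction (ψ : ℝ × ℝ → ℝ) : Prop := ContDiff ℝ ∞ ψ ∧ HasCompactSupport ψ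

/-- `φ_h(x, y) = h⁻² φ(x / h, y / h)`. -/
def scaledKernel (φ : ℝ × ℝ → ℝ) (h : ℝ) (p : ℝ × ℝ) : ℝ := 1 / h ^ 2 * φ (p.1 / h, p.2 / h)

/-- `ρ^ε(·, t) = X^ε(·, t) * φ_{ε^α}`. -/
def mollified (φ : ℝ × ℝ → ℝ) (α : ℝ) (X : ℝ → ℝ → (ℝ × ℝ →ᵇ ℝ)) (ε t : ℝ) : ℝ × ℝ → ℝ :=
  convolution (X ε t) (scaledKernel φ (ε ^ α)) (ContinuousLinearMap.mul ℝ ℝ) volume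

/-- `-P'(r) ∂ₓ r - Q'(r) ∂_y r`, with time as a parameter. -/
def pressureSource (P Q : Polynomial ℝ) (r : ℝ → ℝ × ℝ → ℝ) (t : ℝ) (p : ℝ × ℝ) : ℝ :=
  -(P.derivative.eval (r t p) * partialX (r t) p)
    - Q.derivative.eval (r t p) * partialY (r t) p

/-- The integrand of the weak form in space of `∂_t q + ∂ₓ F + ∂_y G`, tested against `ψ`. -/
def weakIntegrand (q F G : ℝ → ℝ × ℝ → ℝ) (ψ : ℝ × ℝ → ℝ) (t : ℝ) (p : ℝ × ℝ) : ℝ :=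
  derivWithin (fun s : ℝ => q s p) (Ici 0) t * ψ p
    - F t p * partialX ψ p - G t p * partialY ψ p

/-- The families `q ε t (x, y)`, `F ε t (x, y)`, `G ε t (x, y)` are a weak asymptotic method for
`∂_t q + ∂ₓ F + ∂_y G = 0`: the left-hand side tends to `0` in the sense of distributions in the
space variables as `ε → 0⁺`, uniformly for `t` in bounded intervals. -/
def IsWeakAsymptoticMethod (q F G : ℝ → ℝ → ℝ × ℝ → ℝ) : Prop :=
  (∀ ε ∈ Ioo (0 : ℝ) 1, ∀ t : ℝ, 0 ≤ t → ∀ p : ℝ × ℝ,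
      DifferentiableWithinAt ℝ (fun s : ℝ => q ε s p) (Ici 0) t) ∧
    ∀ ψ : ℝ × ℝ → ℝ, IsTestFunction ψ →
      (∀ ε ∈ Ioo (0 : ℝ) 1, ∀ t : ℝ, 0 ≤ t →
        Integrable (weakIntegrand (q ε) (F ε) (G ε) ψ t)) ∧
      ∀ δ : ℝ, 0 < δ →
        TendstoUniformlyOn (fun ε t : ℝ => ∫ p, weakIntegrand (q ε) (F ε) (G ε) ψ t p)
          (fun _ => 0) (𝓝[>] 0) (Icc 0 δ)

/-- If the regularized initial data `f ε` tend in `L¹(𝕋²)` to some `f₀ ∈ L¹(𝕋²)`, then the initial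
values `q ε 0` tend to `f₀` in the sense of distributions. -/
def AttainsInitialData (f : ℝ → (ℝ × ℝ →ᵇ ℝ)) (q : ℝ → ℝ → ℝ × ℝ → ℝ) : Prop :=
  ∀ f₀ : ℝ × ℝ → ℝ, IsTorusPeriodic f₀ → LocallyIntegrable f₀ →
    Tendsto (fun ε : ℝ => torusL1 (fun p => f ε p - f₀ p)) (𝓝[>] 0) (𝓝 0) →
      ∀ ψ : ℝ × ℝ → ℝ, IsTestFunction ψ →
        Tendsto (fun ε : ℝ => ∫ p, q ε 0 p * ψ p) (𝓝[>] 0) (𝓝 (∫ p, f₀ p * ψ p))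

end

/-! For fixed `ε` the upwind operator is bounded on `C_b(ℝ²)`, with norm at most `8(‖u‖ + ‖v‖)/ε`,
so both equations are linear ODEs with bounded coefficients. A weighted Picard iteration solves them
globally, and uniqueness transfers the periodicity of the data to the solutions.

The key is the conservative form `A X = ε⁻¹ ∑ᵢ (τᵢ - 1)(X aᵢ)`, where `τᵢ` translates by `ε` in one
of the four axis directions and the weights `aᵢ ≥ 0` are `u⁺, u⁻, v⁺, v⁻`, with sum `|u| + |v|`. An
Euler step of small length has nonnegative coefficients, and translations preserve integrals over a
period, so the step does not increase the `L¹` norm (`torusL1_euler_le`). A comparison argument for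
one-sided slopes carries this to the ODE (`torusL1_solution_le`): the norm of `X` stays below its
initial value, and that of `w` grows at most linearly, at a rate controlled by the sup norm of the
source.

Put `h = ε^α`. A kernel at scale `h` turns an `L¹` bound into a sup bound at the price `h⁻²`, and
each derivative costs one more `h⁻¹`. With `d = deg P' + deg Q'` the pressure source is therefore
`O(h^{-(2d+3)})`, which gives `N = 2d + 3`.

For weak consistency the translations are moved onto the test function. Taylor expansion and `∑ᵢ aᵢ
eᵢ = (u, v)` leave an error `O(ε)` times an `L¹` norm (`IsTestFunction.exists_upwind_bound`). For
`ρ` one must also exchange mollification with multiplication by the velocities; this commutator is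
`O(ε^{-β} h) = O(ε^{α-β})` (`exists_commutator_bound`). In the equation for `w` the pressure terms
cancel exactly by parts, and the remaining error is `O(ε · ε^{-Nα})`, whence the condition `Nα < 1`.
-/

/-! ### Linear ODEs with bounded coefficients in a Banach space. -/

section LinearODE

variable {E : Type*} [NormedAddCommGroup E] [NormedSpace ℝ E]

/-- The weight absorbs the exponential growth of the integral, so the bound does not depend on `τ`.
This yields both the boundedness and the contraction estimate of the Picard map on the whole
half-line at once. -/
theorem norm_exp_smul_integral_le {g : ℝ → E} {c l τ : ℝ} (hl : 0 < l) (hτ : 0 ≤ τ) (hc : 0 ≤ c)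
    (hg : ∀ s, 0 ≤ s → ‖g s‖ ≤ c * Real.exp (l * s)) :
    ‖Real.exp (-(l * τ)) • ∫ s in (0 : ℝ)..τ, g s‖ ≤ c / l := by
  have hint : ∫ s in (0 : ℝ)..τ, c * Real.exp (l * s) = c / l * (Real.exp (l * τ) - 1) := by
    have hd : ∀ x ∈ uIcc 0 τ, HasDerivAt (fun s => c / l * Real.exp (l * s))
        (c * Real.exp (l * x)) x := fun x _ => by
      have h := (((hasDerivAt_id x).const_mul l).exp).const_mul (c / l)
      convert! h using 1
      simp only [id]
      field_simp
    rw [intervalIntegral.integral_eq_sub_of_hasDerivAt hd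
      (Continuous.intervalIntegrable (by fun_prop) _ _)]
    simp
    ring
  have h1 : ‖∫ s in (0 : ℝ)..τ, g s‖ ≤ c / l * (Real.exp (l * τ) - 1) := by
    rw [← hint]
    exact intervalIntegral.norm_integral_le_of_norm_le hτ
      (ae_of_all _ fun s hs => hg s hs.1.le) (Continuous.intervalIntegrable (by fun_prop) _ _)
  rw [norm_smul, Real.norm_of_nonneg (Real.exp_pos _).le]
  have h2 : Real.exp (-(l * τ)) * Real.exp (l * τ) = 1 := by rw [← Real.exp_add]; simp
  have h3 : 0 ≤ c / l := by positivity
  have h4 := Real.exp_pos (-(l * τ))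
  calc Real.exp (-(l * τ)) * ‖∫ s in (0 : ℝ)..τ, g s‖
      ≤ Real.exp (-(l * τ)) * (c / l * (Real.exp (l * τ) - 1)) := by gcongr
    _ = c / l * (Real.exp (-(l * τ)) * Real.exp (l * τ)) - c / l * Real.exp (-(l * τ)) := by ring
    _ ≤ c / l := by rw [h2]; nlinarith [mul_nonneg h3 h4.le]

/-- The Picard map of the equation `dx/dt = A x + b`, conjugated by the weight `exp (-l t)`, has a fixed
point. -/
theorem exists_weighted_picard [CompleteSpace E] {A : ℝ → E →L[ℝ] E} {b : ℝ → E}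
    (hA : Continuous A) (hb : Continuous b) {K B : ℝ} (hK0 : 0 < K)
    (hK : ∀ t, ‖A t‖ ≤ K) (hB : ∀ t, ‖b t‖ ≤ B) (x₀ : E) :
    ∃ Y : ℝ →ᵇ E, ∀ t : ℝ, 0 ≤ t → Y t = Real.exp (-(2 * K * t)) •
      (x₀ + ∫ s in (0 : ℝ)..t, (Real.exp (2 * K * s) • A s (Y s) + b s)) := by
  have hB0 : 0 ≤ B := (norm_nonneg _).trans (hB 0)
  have hcont : ∀ Y : ℝ →ᵇ E, Continuous fun s => Real.exp (2 * K * s) • A s (Y s) + b s :=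
    fun Y => ((by fun_prop : Continuous fun s : ℝ => Real.exp (2 * K * s)).smul
      (hA.clm_apply Y.continuous)).add hb
  have hexp : ∀ s : ℝ, 0 ≤ s → 1 ≤ Real.exp (2 * K * s) := fun s hs =>
    Real.one_le_exp (by positivity)
  have hbd : ∀ (Y : ℝ →ᵇ E) (s : ℝ), 0 ≤ s →
      ‖Real.exp (2 * K * s) • A s (Y s) + b s‖ ≤ (K * ‖Y‖ + B) * Real.exp (2 * K * s) := by
    intro Y s hs
    have h1 : ‖A s (Y s)‖ ≤ K * ‖Y‖ :=
      (A s).le_of_opNorm_le_of_le (hK s) (Y.norm_coe_le_norm s)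
    have h2 := hexp s hs
    calc _ ≤ ‖Real.exp (2 * K * s) • A s (Y s)‖ + ‖b s‖ := norm_add_le _ _
      _ = Real.exp (2 * K * s) * ‖A s (Y s)‖ + ‖b s‖ := by
        rw [norm_smul, Real.norm_of_nonneg (Real.exp_pos _).le]
      _ ≤ Real.exp (2 * K * s) * (K * ‖Y‖) + B * Real.exp (2 * K * s) := by
        gcongr
        exact (hB s).trans (le_mul_of_one_le_right hB0 h2)
      _ = _ := by ring
  -- Replacing `t` by `max t 0` makes the map act on bounded continuous functions on all of `ℝ`; its
  -- values at negative times play no role.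
  let F : (ℝ →ᵇ E) → (ℝ →ᵇ E) := fun Y => BoundedContinuousFunction.ofNormedAddCommGroup
    (fun t : ℝ => Real.exp (-(2 * K * max t 0)) •
      (x₀ + ∫ s in (0 : ℝ)..(max t 0), (Real.exp (2 * K * s) • A s (Y s) + b s)))
    ((by fun_prop : Continuous fun t : ℝ => Real.exp (-(2 * K * max t 0))).smul
      (continuous_const.add ((intervalIntegral.continuous_primitive
        (fun _ _ => (hcont Y).intervalIntegrable _ _) 0).comp (by fun_prop))))
    (‖x₀‖ + (K * ‖Y‖ + B) / (2 * K)) (fun t => by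
      have ht : (0 : ℝ) ≤ max t 0 := le_max_right _ _
      rw [smul_add]
      refine (norm_add_le _ _).trans (add_le_add ?_ ?_)
      · rw [norm_smul, Real.norm_of_nonneg (Real.exp_pos _).le]
        exact mul_le_of_le_one_left (norm_nonneg _)
          (Real.exp_le_one_iff.2 (by simp only [Left.neg_nonpos_iff]; positivity))
      · exact norm_exp_smul_integral_le (by positivity) ht (by positivity) (hbd Y))
  -- The rate `2 * K` of the weight produces the factor `K / (2 * K) = 1 / 2`.
  have hF : ContractingWith (1 / 2) F := by
    refine ⟨by rw [← NNReal.coe_lt_coe]; norm_num, LipschitzWith.of_dist_le_mul fun Y Z => ?_⟩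
    refine (BoundedContinuousFunction.dist_le (by positivity)).2 fun t => ?_
    have ht : (0 : ℝ) ≤ max t 0 := le_max_right _ _
    have h1 : F Y t - F Z t = Real.exp (-(2 * K * max t 0)) •
        ∫ s in (0 : ℝ)..(max t 0), Real.exp (2 * K * s) • A s ((Y - Z) s) := by
      simp only [F, BoundedContinuousFunction.coe_ofNormedAddCommGroup]
      rw [← smul_sub, add_sub_add_left_eq_sub, ← intervalIntegral.integral_sub
        ((hcont Y).intervalIntegrable _ _) ((hcont Z).intervalIntegrable _ _)]
      congr 1
      refine intervalIntegral.integral_congr fun s _ => ?_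
      simp [smul_sub]
    rw [dist_eq_norm, h1]
    refine (norm_exp_smul_integral_le (c := K * ‖Y - Z‖) (by positivity) ht (by positivity)
      fun s _ => ?_).trans ?_
    · rw [norm_smul, Real.norm_of_nonneg (Real.exp_pos _).le, mul_comm]
      gcongr
      exact (A s).le_of_opNorm_le_of_le (hK s) ((Y - Z).norm_coe_le_norm s)
    · rw [dist_eq_norm]
      have : ((1 / 2 : NNReal) : ℝ) = 1 / 2 := by norm_num
      rw [this]
      apply le_of_eq
      field_simp
  obtain ⟨Y, hY⟩ : ∃ Y, F Y = Y := ⟨_, hF.fixedPoint_isFixedPt⟩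
  refine ⟨Y, fun t ht => ?_⟩
  have h : F Y t = Real.exp (-(2 * K * max t 0)) •
      (x₀ + ∫ s in (0 : ℝ)..(max t 0), (Real.exp (2 * K * s) • A s (Y s) + b s)) := rfl
  rwa [hY, max_eq_left ht] at h

/-- The coefficients are frozen at their value at `0` for negative times. Undoing the weight on the
Picard fixed point gives the integral equation, which is then differentiated. -/
theorem exists_solution_linearODE [CompleteSpace E] {A : ℝ → E →L[ℝ] E} {b : ℝ → E}
    (hA : ContinuousOn A (Ici 0)) (hb : ContinuousOn b (Ici 0)) {K B : ℝ}
    (hK : ∀ t, 0 ≤ t → ‖A t‖ ≤ K) (hB : ∀ t, 0 ≤ t → ‖b t‖ ≤ B) (x₀ : E) :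
    ∃ x : ℝ → E, x 0 = x₀ ∧
      ∀ t, 0 ≤ t → HasDerivWithinAt x (A t (x t) + b t) (Ici 0) t := by
  have hm : Continuous fun t : ℝ => max t 0 := by fun_prop
  have hm' : ∀ t : ℝ, max t 0 ∈ Ici (0 : ℝ) := fun t => mem_Ici.2 (le_max_right _ _)
  have hA' : Continuous fun t => A (max t 0) := hA.comp_continuous hm hm'
  have hb' : Continuous fun t => b (max t 0) := hb.comp_continuous hm hm'
  have hK0 : 0 ≤ K := (norm_nonneg _).trans (hK 0 le_rfl)
  -- The Picard lemma needs a strictly positive bound, whereas `K` may vanish; hence `K + 1`.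
  obtain ⟨Y, hY⟩ := exists_weighted_picard hA' hb' (K := K + 1) (by positivity)
    (fun t => (hK _ (hm' t)).trans (by linarith)) (fun t => hB _ (hm' t)) x₀
  set l := 2 * (K + 1)
  have hx : ∀ t, 0 ≤ t → Real.exp (l * t) • Y t = x₀ + ∫ s in (0 : ℝ)..t,
      (Real.exp (l * s) • A (max s 0) (Y s) + b (max s 0)) := fun t ht => by
    rw [hY t ht, smul_smul, ← Real.exp_add]
    simp
  have hg : Continuous fun s => Real.exp (l * s) • A (max s 0) (Y s) + b (max s 0) :=
    ((by fun_prop : Continuous fun s : ℝ => Real.exp (l * s)).smul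
      (hA'.clm_apply Y.continuous)).add hb'
  refine ⟨fun t => Real.exp (l * t) • Y t, ?_, fun t ht => ?_⟩
  · simpa using hx 0 le_rfl
  · have h1 := ((intervalIntegral.integral_hasDerivAt_right (hg.intervalIntegrable 0 t)
      hg.aestronglyMeasurable.stronglyMeasurableAtFilter hg.continuousAt).const_add
        x₀).hasDerivWithinAt (s := Ici 0)
    have h2 := h1.congr (f₁ := fun t => Real.exp (l * t) • Y t) (fun s hs => hx s hs) (hx t ht)
    simpa [max_eq_left ht] using h2

theorem linearODE_unique {A : ℝ → E →L[ℝ] E} {b : ℝ → E} {K : ℝ}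
    (hK : ∀ t, 0 ≤ t → ‖A t‖ ≤ K) {x y : ℝ → E}
    (hx : ∀ t, 0 ≤ t → HasDerivWithinAt x (A t (x t) + b t) (Ici 0) t)
    (hy : ∀ t, 0 ≤ t → HasDerivWithinAt y (A t (y t) + b t) (Ici 0) t) (h0 : x 0 = y 0)
    {t : ℝ} (ht : 0 ≤ t) : x t = y t := by
  refine ODE_solution_unique_of_mem_Icc_right (v := fun t z => A t z + b t) (K := K.toNNReal)
    (s := fun _ => univ) (a := 0) (b := t) (fun s hs => ?_) (fun s hs => ?_) (fun s hs => ?_)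
    (fun _ _ => mem_univ _) (fun s hs => ?_) (fun s hs => ?_) (fun _ _ => mem_univ _) h0
    ⟨ht, le_rfl⟩
  · refine (LipschitzWith.of_dist_le_mul fun z w => ?_).lipschitzOnWith
    rw [dist_add_right, dist_eq_norm, dist_eq_norm, ← map_sub]
    exact (A s).le_of_opNorm_le ((hK s hs.1).trans (Real.le_coe_toNNReal K)) _
  · exact (hx s hs.1).continuousWithinAt.mono Icc_subset_Ici_self
  · exact (hx s hs.1).mono (Ici_subset_Ici.2 hs.1)
  · exact (hy s hs.1).continuousWithinAt.mono Icc_subset_Ici_self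
  · exact (hy s hs.1).mono (Ici_subset_Ici.2 hs.1)

end LinearODE

/-! ### Periodic functions and the `L¹` norm on the torus. -/

section Torus

/-- The period square `[-π, π]²`. -/
abbrev torusBox : Set (ℝ × ℝ) := Icc (-Real.pi) Real.pi ×ˢ Icc (-Real.pi) Real.pi

theorem isCompact_torusBox : IsCompact torusBox := isCompact_Icc.prod isCompact_Icc

theorem measurableSet_torusBox : MeasurableSet torusBox := isCompact_torusBox.measurableSet

theorem torusL1_nonneg (f : ℝ × ℝ → ℝ) : 0 ≤ torusL1 f :=
  integral_nonneg fun _ => abs_nonneg _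

theorem isTorusPeriodic_iff {f : ℝ × ℝ → ℝ} : IsTorusPeriodic f ↔
    (∀ p, f (p + (2 * Real.pi, 0)) = f p) ∧ ∀ p, f (p + (0, 2 * Real.pi)) = f p := by
  constructor
  · intro h
    refine ⟨fun ⟨x, y⟩ => ?_, fun ⟨x, y⟩ => ?_⟩
    · simpa using (h x y).1
    · simpa using (h x y).2
  · intro h x y
    refine ⟨?_, ?_⟩
    · simpa using h.1 (x, y)
    · simpa using h.2 (x, y)

theorem IsTorusPeriodic.comp {f : ℝ × ℝ → ℝ} (hf : IsTorusPeriodic f) (g : ℝ → ℝ) :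
    IsTorusPeriodic fun p => g (f p) := fun x y => by
  simp only [(hf x y).1, (hf x y).2, and_self]

theorem IsTorusPeriodic.mul {f g : ℝ × ℝ → ℝ} (hf : IsTorusPeriodic f) (hg : IsTorusPeriodic g) :
    IsTorusPeriodic fun p => f p * g p := fun x y => by
  simp only [(hf x y).1, (hf x y).2, (hg x y).1, (hg x y).2, and_self]

theorem IsTorusPeriodic.sub {f g : ℝ × ℝ → ℝ} (hf : IsTorusPeriodic f) (hg : IsTorusPeriodic g) :
    IsTorusPeriodic fun p => f p - g p := fun x y => by
  simp only [(hf x y).1, (hf x y).2, (hg x y).1, (hg x y).2, and_self]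

theorem IsTorusPeriodic.add_const {f : ℝ × ℝ → ℝ} (hf : IsTorusPeriodic f) (a : ℝ × ℝ) :
    IsTorusPeriodic fun p => f (p + a) := by
  rw [isTorusPeriodic_iff] at hf ⊢
  refine ⟨fun p => ?_, fun p => ?_⟩
  · rw [add_right_comm, hf.1]
  · rw [add_right_comm, hf.2]

theorem IsTorusPeriodic.int_translate {f : ℝ × ℝ → ℝ} (hf : IsTorusPeriodic f) (i j : ℤ)
    (p : ℝ × ℝ) : f (p - (i * (2 * Real.pi), j * (2 * Real.pi))) = f p := by
  have h1 : ∀ y, Function.Periodic (fun x => f (x, y)) (2 * Real.pi) := fun y x => (hf x y).1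
  have h2 : ∀ x, Function.Periodic (fun y => f (x, y)) (2 * Real.pi) := fun x y => (hf x y).2
  have h3 := (h1 (p.2 - j * (2 * Real.pi))).sub_int_mul_eq (x := p.1) i
  have h4 := (h2 p.1).sub_int_mul_eq (x := p.2) j
  exact h3.trans h4

theorem integral_torusBox_eq {f : ℝ × ℝ → ℝ} (hf : Continuous f) :
    ∫ p in torusBox, f p =
      ∫ x in (-Real.pi)..Real.pi, ∫ y in (-Real.pi)..Real.pi, f (x, y) := by
  have hpi : -Real.pi ≤ Real.pi := by linarith [Real.pi_pos]
  rw [Measure.volume_eq_prod, setIntegral_prod _ (hf.continuousOn.integrableOn_compact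
    isCompact_torusBox), intervalIntegral.integral_of_le hpi, integral_Icc_eq_integral_Ioc]
  simp_rw [intervalIntegral.integral_of_le hpi, integral_Icc_eq_integral_Ioc]

theorem Function.Periodic.integral_pi_add {g : ℝ → ℝ} (hg : Function.Periodic g (2 * Real.pi))
    (a : ℝ) : ∫ x in (-Real.pi)..Real.pi, g (x + a) = ∫ x in (-Real.pi)..Real.pi, g x := by
  rw [intervalIntegral.integral_comp_add_right]
  have h := hg.intervalIntegral_add_eq (-Real.pi + a) (-Real.pi)
  have h1 : -Real.pi + a + 2 * Real.pi = Real.pi + a := by ring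
  have h2 : -Real.pi + 2 * Real.pi = Real.pi := by ring
  rwa [h1, h2] at h

/-- The integral over a period does not change under translations. -/
theorem IsTorusPeriodic.integral_add {f : ℝ × ℝ → ℝ} (hp : IsTorusPeriodic f) (hf : Continuous f)
    (a : ℝ × ℝ) : ∫ p in torusBox, f (p + a) = ∫ p in torusBox, f p := by
  rw [integral_torusBox_eq hf, integral_torusBox_eq (by fun_prop)]
  obtain ⟨a, b⟩ := a
  simp only [Prod.mk_add_mk]
  have h1 : ∀ x, ∫ y in (-Real.pi)..Real.pi, f (x + a, y + b) =
      ∫ y in (-Real.pi)..Real.pi, f (x + a, y) := fun x =>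
    Function.Periodic.integral_pi_add (g := fun y => f (x + a, y)) (fun y => (hp _ y).2) b
  simp_rw [h1]
  refine Function.Periodic.integral_pi_add
    (g := fun x => ∫ y in (-Real.pi)..Real.pi, f (x, y)) (fun x => ?_) a
  simp only [(hp x _).1]

theorem IsTorusPeriodic.torusL1_add {f : ℝ × ℝ → ℝ} (hp : IsTorusPeriodic f) (hf : Continuous f)
    (a : ℝ × ℝ) : torusL1 (fun p => f (p + a)) = torusL1 f :=
  (hp.comp abs).integral_add (by fun_prop) a

/-- A ball is covered by finitely many translates of the period square, and `n` is their number.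
Local integrability is all that is assumed because limits of initial data need not be continuous. -/
theorem exists_setIntegral_closedBall_zero_le (R : ℝ) : ∃ n : ℝ, 0 ≤ n ∧ ∀ f : ℝ × ℝ → ℝ,
    IsTorusPeriodic f → LocallyIntegrable f →
      ∫ p in Metric.closedBall 0 R, |f p| ≤ n * torusL1 f := by
  set m : ℤ := ⌈R⌉
  set S := Finset.Icc (-m) m ×ˢ Finset.Icc (-m) m
  refine ⟨S.card, by positivity, fun f hp hf => ?_⟩
  set g := torusBox.indicator fun p => |f p|
  have hg0 : ∀ p, 0 ≤ g p := fun p => indicator_nonneg (fun _ _ => abs_nonneg _) _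
  have hgi : Integrable g := (integrable_indicator_iff measurableSet_torusBox).2
    (hf.integrableOn_isCompact isCompact_torusBox).abs
  have hgt : ∫ p, g p = torusL1 f := integral_indicator measurableSet_torusBox
  set sh : ℤ × ℤ → ℝ × ℝ := fun k => (k.1 * (2 * Real.pi), k.2 * (2 * Real.pi))
  -- Rounding `x / 2π` selects the translate containing `x`. The index stays within `m` because `m /
  -- 6 + 1 / 2 ≤ m` for `m ≥ 1`; the case `m = 0` forces `x = 0`.
  have hround : ∀ x : ℝ, |x| ≤ R →
      round (x / (2 * Real.pi)) ∈ Finset.Icc (-m) m ∧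
        x - round (x / (2 * Real.pi)) * (2 * Real.pi) ∈ Icc (-Real.pi) Real.pi := by
    intro x hx
    have hpi := Real.pi_gt_three
    set r := round (x / (2 * Real.pi))
    have h1 : |x / (2 * Real.pi) - r| ≤ 1 / 2 := abs_sub_round _
    have h2 : |x - r * (2 * Real.pi)| ≤ Real.pi := by
      have : x - r * (2 * Real.pi) = (x / (2 * Real.pi) - r) * (2 * Real.pi) := by
        field_simp
      rw [this, abs_mul, abs_of_pos (by positivity : (0 : ℝ) < 2 * Real.pi)]
      nlinarith
    have hRm : R ≤ m := Int.le_ceil R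
    have hm0 : (0 : ℝ) ≤ m := (abs_nonneg x).trans (hx.trans hRm)
    have hxm : |x / (2 * Real.pi)| ≤ m / 6 := by
      rw [abs_div, abs_of_pos (by positivity : (0 : ℝ) < 2 * Real.pi)]
      exact div_le_div₀ hm0 (hx.trans hRm) (by norm_num) (by linarith)
    refine ⟨?_, abs_le.1 h2⟩
    rw [Finset.mem_Icc]
    rcases hm0.eq_or_lt with h0 | h0
    · have hx0 : x = 0 := abs_nonpos_iff.1 (by linarith)
      have hm' : m = 0 := by exact_mod_cast h0.symm
      simp [r, hx0, hm']
    · have hm1 : (1 : ℝ) ≤ m := by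
        have : (0 : ℤ) < m := by exact_mod_cast h0
        exact_mod_cast this
      rw [abs_le] at h1 hxm
      constructor
      · have : ((-m : ℤ) : ℝ) ≤ r := by push_cast; linarith
        exact_mod_cast this
      · have : (r : ℝ) ≤ m := by linarith
        exact_mod_cast this
  have hle : ∀ p, (Metric.closedBall (0 : ℝ × ℝ) R).indicator (fun p => |f p|) p ≤
      ∑ k ∈ S, g (p - sh k) := by
    intro p
    refine indicator_le' (s := Metric.closedBall (0 : ℝ × ℝ) R)
      (g := fun p => ∑ k ∈ S, g (p - sh k)) (fun q hq => ?_)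
      (fun q _ => Finset.sum_nonneg fun k _ => hg0 _) p
    have hq' : |q.1| ≤ R ∧ |q.2| ≤ R := by
      rw [mem_closedBall_zero_iff, Prod.norm_def] at hq
      exact ⟨(le_max_left _ _).trans hq, (le_max_right _ _).trans hq⟩
    obtain ⟨h1, h1'⟩ := hround q.1 hq'.1
    obtain ⟨h2, h2'⟩ := hround q.2 hq'.2
    refine le_trans (le_of_eq ?_) (Finset.single_le_sum (f := fun k => g (q - sh k))
      (fun k _ => hg0 _) (Finset.mem_product.2 ⟨h1, h2⟩ :
        (round (q.1 / (2 * Real.pi)), round (q.2 / (2 * Real.pi))) ∈ S))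
    simp only [g]
    rw [indicator_of_mem (show q - sh _ ∈ torusBox from ⟨h1', h2'⟩)]
    simp only [sh]
    rw [hp.int_translate]
  have hb : MeasurableSet (Metric.closedBall (0 : ℝ × ℝ) R) := measurableSet_closedBall
  rw [← integral_indicator hb]
  refine (integral_mono ((integrable_indicator_iff hb).2
    (hf.integrableOn_isCompact (isCompact_closedBall _ _)).abs)
    (integrable_finsetSum S fun k _ => hgi.comp_sub_right (sh k)) hle).trans (le_of_eq ?_)
  rw [integral_finsetSum S fun k _ => hgi.comp_sub_right (sh k)]
  simp_rw [integral_sub_right_eq_self, hgt]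
  simp

/-- Recentring the ball translates `f`, which leaves the torus norm unchanged; so one constant
serves all centres. -/
theorem exists_setIntegral_closedBall_le (R : ℝ) : ∃ n : ℝ, 0 ≤ n ∧ ∀ f : ℝ × ℝ → ℝ,
    IsTorusPeriodic f → Continuous f → ∀ c,
      ∫ p in Metric.closedBall c R, |f p| ≤ n * torusL1 f := by
  obtain ⟨n, hn, h⟩ := exists_setIntegral_closedBall_zero_le R
  refine ⟨n, hn, fun f hp hf c => ?_⟩
  have h1 := h _ (hp.add_const c) (by fun_prop : Continuous fun p => f (p + c)).locallyIntegrable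
  rw [hp.torusL1_add hf] at h1
  refine le_trans (le_of_eq ?_) h1
  rw [← integral_indicator measurableSet_closedBall, ← integral_indicator measurableSet_closedBall,
    ← integral_add_right_eq_self _ c]
  congr 1
  ext p
  simp only [indicator, Metric.mem_closedBall, dist_eq_norm, add_sub_cancel_right, sub_zero]

theorem torusL1_mono {f g : ℝ × ℝ → ℝ} (hf : Continuous f) (hg : Continuous g)
    (h : ∀ p, |f p| ≤ |g p|) : torusL1 f ≤ torusL1 g :=
  setIntegral_mono (hf.abs.continuousOn.integrableOn_compact isCompact_torusBox)
    (hg.abs.continuousOn.integrableOn_compact isCompact_torusBox) h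

theorem torusL1_const (c : ℝ) : torusL1 (fun _ => c) = (2 * Real.pi) ^ 2 * |c| := by
  have := integral_torusBox_eq (f := fun _ => |c|) continuous_const
  unfold torusL1
  rw [this]
  simp
  ring

theorem torusL1_add_le {f g : ℝ × ℝ → ℝ} (hf : Continuous f) (hg : Continuous g) :
    torusL1 (fun p => f p + g p) ≤ torusL1 f + torusL1 g := by
  have h1 := hf.abs.continuousOn.integrableOn_compact (μ := volume) isCompact_torusBox
  have h2 := hg.abs.continuousOn.integrableOn_compact (μ := volume) isCompact_torusBox
  unfold torusL1
  rw [← integral_add h1 h2]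
  exact setIntegral_mono ((hf.add hg).abs.continuousOn.integrableOn_compact isCompact_torusBox)
    (h1.add h2) fun p => abs_add_le _ _

end Torus

/-! ### Partial derivatives and test functions. -/

section PartialDerivatives

theorem DifferentiableAt.partialX_eq {f : ℝ × ℝ → ℝ} {p : ℝ × ℝ} (hf : DifferentiableAt ℝ f p) :
    partialX f p = fderiv ℝ f p (1, 0) := by
  have h : HasDerivAt (fun s : ℝ => (s, p.2)) ((1 : ℝ), (0 : ℝ)) p.1 :=
    (hasDerivAt_id p.1).prodMk (hasDerivAt_const _ _)
  exact (hf.hasFDerivAt.comp_hasDerivAt p.1 h).deriv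

theorem DifferentiableAt.partialY_eq {f : ℝ × ℝ → ℝ} {p : ℝ × ℝ} (hf : DifferentiableAt ℝ f p) :
    partialY f p = fderiv ℝ f p (0, 1) := by
  have h : HasDerivAt (fun s : ℝ => (p.1, s)) ((0 : ℝ), (1 : ℝ)) p.2 :=
    (hasDerivAt_const _ _).prodMk (hasDerivAt_id p.2)
  exact (hf.hasFDerivAt.comp_hasDerivAt p.2 h).deriv

namespace IsTestFunction

variable {ψ : ℝ × ℝ → ℝ}

theorem contDiff_one (h : IsTestFunction ψ) : ContDiff ℝ 1 ψ := h.1.of_le (by exact_mod_cast le_top)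

theorem differentiable (h : IsTestFunction ψ) : Differentiable ℝ ψ :=
  h.contDiff_one.differentiable one_ne_zero

theorem partialX_eq (h : IsTestFunction ψ) : partialX ψ = fun p => fderiv ℝ ψ p (1, 0) :=
  funext fun p => (h.differentiable p).partialX_eq

theorem partialY_eq (h : IsTestFunction ψ) : partialY ψ = fun p => fderiv ℝ ψ p (0, 1) :=
  funext fun p => (h.differentiable p).partialY_eq

theorem continuous_fderiv_apply (h : IsTestFunction ψ) (e : ℝ × ℝ) :
    Continuous fun p => fderiv ℝ ψ p e :=
  (h.contDiff_one.continuous_fderiv one_ne_zero).clm_apply continuous_const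

theorem hasCompactSupport_fderiv_apply (h : IsTestFunction ψ) (e : ℝ × ℝ) :
    HasCompactSupport fun p => fderiv ℝ ψ p e := h.2.fderiv_apply ℝ e

theorem continuous_partialX (h : IsTestFunction ψ) : Continuous (partialX ψ) :=
  h.partialX_eq ▸ h.continuous_fderiv_apply _

theorem continuous_partialY (h : IsTestFunction ψ) : Continuous (partialY ψ) :=
  h.partialY_eq ▸ h.continuous_fderiv_apply _

theorem hasCompactSupport_partialX (h : IsTestFunction ψ) : HasCompactSupport (partialX ψ) :=
  h.partialX_eq ▸ h.hasCompactSupport_fderiv_apply _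

theorem hasCompactSupport_partialY (h : IsTestFunction ψ) : HasCompactSupport (partialY ψ) :=
  h.partialY_eq ▸ h.hasCompactSupport_fderiv_apply _

end IsTestFunction

theorem HasCompactSupport.exists_radius {k : ℝ × ℝ → ℝ} (hk : HasCompactSupport k) :
    ∃ R : ℝ, 0 ≤ R ∧ ∀ p, k p ≠ 0 → ‖p‖ ≤ R := by
  obtain ⟨R, hR⟩ := hk.isCompact.isBounded.subset_closedBall 0
  refine ⟨max R 0, le_max_right _ _, fun p hp => ?_⟩
  have := hR (subset_tsupport _ hp)
  rw [mem_closedBall_zero_iff] at this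
  exact this.trans (le_max_left _ _)

end PartialDerivatives

theorem abs_integral_le_of_abs_le {f g : ℝ × ℝ → ℝ} (hg : Integrable g)
    (h : ∀ p, |f p| ≤ g p) : |∫ p, f p| ≤ ∫ p, g p := by
  rw [← Real.norm_eq_abs]
  exact norm_integral_le_of_norm_le hg (ae_of_all _ h)

/-! ### Convolution of periodic functions with compactly supported kernels. -/

section Convolution

/-- Convolution of real functions on the plane. -/
noncomputable abbrev planeConv (f k : ℝ × ℝ → ℝ) : ℝ × ℝ → ℝ :=
  convolution f k (ContinuousLinearMap.mul ℝ ℝ) volume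

theorem planeConv_apply (f k : ℝ × ℝ → ℝ) (p : ℝ × ℝ) :
    planeConv f k p = ∫ q, f q * k (p - q) := rfl

theorem planeConv_apply_swap (f k : ℝ × ℝ → ℝ) (p : ℝ × ℝ) :
    planeConv f k p = ∫ q, f (p - q) * k q :=
  convolution_eq_swap _

theorem continuous_planeConv {f k : ℝ × ℝ → ℝ} (hf : Continuous f) (hk : Continuous k)
    (hk' : HasCompactSupport k) : Continuous (planeConv f k) :=
  hk'.continuous_convolution_right _ hf.locallyIntegrable hk

theorem integrable_mul_comp_sub {f k : ℝ × ℝ → ℝ} (hf : Continuous f) (hk : Continuous k)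
    (hk' : HasCompactSupport k) (p : ℝ × ℝ) : Integrable fun q => f q * k (p - q) :=
  Continuous.integrable_of_hasCompactSupport (by fun_prop)
    (HasCompactSupport.mul_left (hk'.comp_homeomorph (Homeomorph.subLeft p)))

theorem abs_planeConv_le (f : ℝ × ℝ →ᵇ ℝ) {k : ℝ × ℝ → ℝ} (hk : Continuous k)
    (hk' : HasCompactSupport k) (p : ℝ × ℝ) :
    |planeConv f k p| ≤ (∫ q, |k q|) * ‖f‖ := by
  rw [planeConv_apply_swap, mul_comm, ← integral_const_mul]
  refine abs_integral_le_of_abs_le ((hk.integrable_of_hasCompactSupport (μ := volume) hk').abs.const_mul _)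
    fun q => ?_
  rw [abs_mul]
  gcongr
  exact f.norm_coe_le_norm _

/-- Convolution with a continuous compactly supported kernel, as an operator on the bounded
continuous functions. -/
noncomputable def convCLM (k : ℝ × ℝ → ℝ) (hk : Continuous k) (hk' : HasCompactSupport k) :
    (ℝ × ℝ →ᵇ ℝ) →L[ℝ] (ℝ × ℝ →ᵇ ℝ) :=
  LinearMap.mkContinuous
    { toFun := fun f => BoundedContinuousFunction.ofNormedAddCommGroup (planeConv f k)
        (continuous_planeConv f.continuous hk hk') ((∫ q, |k q|) * ‖f‖)
        (abs_planeConv_le f hk hk')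
      map_add' := fun f g => by
        ext p
        simp only [BoundedContinuousFunction.coe_ofNormedAddCommGroup,
          BoundedContinuousFunction.coe_add, Pi.add_apply, planeConv_apply, add_mul]
        exact integral_add (integrable_mul_comp_sub f.continuous hk hk' p)
          (integrable_mul_comp_sub g.continuous hk hk' p)
      map_smul' := fun c f => by
        ext p
        simp only [BoundedContinuousFunction.coe_ofNormedAddCommGroup,
          BoundedContinuousFunction.coe_smul, planeConv_apply, smul_eq_mul, mul_assoc,
          RingHom.id_apply]
        exact integral_const_mul _ _ }
    (∫ q, |k q|) (fun f =>
      BoundedContinuousFunction.norm_ofNormedAddCommGroup_le _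
        (mul_nonneg (integral_nonneg fun _ => abs_nonneg _) (norm_nonneg _))
        (abs_planeConv_le f hk hk'))

theorem IsTorusPeriodic.planeConv {f : ℝ × ℝ → ℝ} (hf : IsTorusPeriodic f) (k : ℝ × ℝ → ℝ) :
    IsTorusPeriodic (planeConv f k) := by
  rw [isTorusPeriodic_iff] at hf ⊢
  refine ⟨fun p => ?_, fun p => ?_⟩
  · simp only [planeConv_apply_swap, add_sub_right_comm, hf.1]
  · simp only [planeConv_apply_swap, add_sub_right_comm, hf.2]

theorem planeConv_add_const (f k : ℝ × ℝ → ℝ) (a p : ℝ × ℝ) :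
    planeConv f k (p + a) = planeConv (fun q => f (q + a)) k p := by
  simp only [planeConv_apply_swap, add_sub_right_comm]

/-- Young's inequality on the torus: exchange the integrals, then use translation invariance over a
period. -/
theorem torusL1_planeConv_le {f k : ℝ × ℝ → ℝ} (hp : IsTorusPeriodic f) (hf : Continuous f)
    (hk : Continuous k) (hk' : HasCompactSupport k) :
    torusL1 (planeConv f k) ≤ torusL1 f * ∫ q, |k q| := by
  have hkc : HasCompactSupport fun q => |k q| := hk'.comp_left (g := abs) abs_zero
  -- The integrand vanishes when the second variable leaves the support of `k`, so integrability on
  -- a compact product suffices.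
  have hint : Integrable (Function.uncurry fun p q : ℝ × ℝ => |f (p - q)| * |k q|)
      ((volume.restrict torusBox).prod volume) := by
    rw [← Measure.restrict_univ (μ := (volume : Measure (ℝ × ℝ))), Measure.restrict_restrict
      measurableSet_torusBox, Measure.prod_restrict, inter_univ]
    have hc : Continuous (Function.uncurry fun p q : ℝ × ℝ => |f (p - q)| * |k q|) := by
      unfold Function.uncurry
      fun_prop
    have h1 := hc.continuousOn.integrableOn_compact (μ := volume)
      (isCompact_torusBox.prod hk'.isCompact)
    refine h1.of_forall_sdiff_eq_zero (measurableSet_torusBox.prod MeasurableSet.univ)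
      fun x hx => ?_
    have : x.2 ∉ tsupport k := fun h => hx.2 ⟨hx.1.1, h⟩
    simp [Function.uncurry, image_eq_zero_of_notMem_tsupport this]
  calc torusL1 (planeConv f k) ≤ ∫ p in torusBox, ∫ q, |f (p - q)| * |k q| := by
        refine setIntegral_mono ((continuous_planeConv hf hk hk').abs.continuousOn.integrableOn_compact
          isCompact_torusBox) hint.integral_prod_left fun p => ?_
        simp only [planeConv_apply_swap, ← abs_mul]
        exact abs_integral_le_integral_abs
    _ = ∫ q, ∫ p in torusBox, |f (p - q)| * |k q| := integral_integral_swap hint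
    _ = ∫ q, torusL1 f * |k q| := by
        congr 1
        ext q
        rw [integral_mul_const]
        congr 1
        simp_rw [sub_eq_add_neg]
        exact hp.torusL1_add hf (-q)
    _ = _ := integral_const_mul _ _

theorem contDiff_planeConv {f k : ℝ × ℝ → ℝ} (hf : Continuous f) (hk : IsTestFunction k) :
    ContDiff ℝ ∞ (planeConv f k) :=
  hk.2.contDiff_convolution_right _ hf.locallyIntegrable hk.1

theorem fderiv_planeConv {f k : ℝ × ℝ → ℝ} (hf : Continuous f) (hk : IsTestFunction k)
    (p e : ℝ × ℝ) : fderiv ℝ (planeConv f k) p e = planeConv f (fun q => fderiv ℝ k q e) p := by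
  rw [(hk.2.hasFDerivAt_convolution_right _ hf.locallyIntegrable hk.contDiff_one p).fderiv,
    convolution_precompR_apply _ hf.locallyIntegrable (hk.2.fderiv ℝ)
      (hk.contDiff_one.continuous_fderiv one_ne_zero)]

theorem partialX_planeConv {f k : ℝ × ℝ → ℝ} (hf : Continuous f) (hk : IsTestFunction k)
    (p : ℝ × ℝ) : partialX (planeConv f k) p = planeConv f (partialX k) p := by
  rw [((contDiff_planeConv hf hk).differentiable (by simp) p).partialX_eq, fderiv_planeConv hf hk,
    hk.partialX_eq]

theorem partialY_planeConv {f k : ℝ × ℝ → ℝ} (hf : Continuous f) (hk : IsTestFunction k)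
    (p : ℝ × ℝ) : partialY (planeConv f k) p = planeConv f (partialY k) p := by
  rw [((contDiff_planeConv hf hk).differentiable (by simp) p).partialY_eq, fderiv_planeConv hf hk,
    hk.partialY_eq]

/-- Commutator of a convolution with the multiplication by a Lipschitz function. -/
theorem abs_planeConv_mul_sub_le {f g k : ℝ × ℝ → ℝ} (hf : Continuous f) (hg : Continuous g)
    (hk : Continuous k) (hk' : HasCompactSupport k) {Λ r : ℝ} (hΛ : 0 ≤ Λ)
    (hL : ∀ p q, |g q - g p| ≤ Λ * ‖p - q‖) (hr : ∀ p, k p ≠ 0 → ‖p‖ ≤ r) (p : ℝ × ℝ) :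
    |planeConv (fun q => f q * g q) k p - g p * planeConv f k p| ≤
      Λ * r * planeConv (fun q => |f q|) (fun q => |k q|) p := by
  have hkc : HasCompactSupport fun q => |k q| := hk'.comp_left (g := abs) abs_zero
  simp only [planeConv_apply]
  rw [← integral_const_mul, ← integral_const_mul, ← integral_sub
    (integrable_mul_comp_sub (f := fun q => f q * g q) (hf.mul hg) hk hk' p)
    ((integrable_mul_comp_sub hf hk hk' p).const_mul _)]
  refine abs_integral_le_of_abs_le
    ((integrable_mul_comp_sub hf.abs hk.abs hkc p).const_mul _) fun q => ?_
  have h1 : f q * g q * k (p - q) - g p * (f q * k (p - q)) =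
      (g q - g p) * (f q * k (p - q)) := by ring
  rw [h1, abs_mul, abs_mul]
  by_cases h0 : k (p - q) = 0
  · simp [h0]
  · gcongr
    exact (hL p q).trans (mul_le_mul_of_nonneg_left (hr _ h0) hΛ)

end Convolution

/-! ### Scaling of the mollifier. -/

section ScaledKernel

variable {k : ℝ × ℝ → ℝ} {h : ℝ}

theorem scaledKernel_eq_smul (k : ℝ × ℝ → ℝ) (h : ℝ) (p : ℝ × ℝ) :
    scaledKernel k h p = 1 / h ^ 2 * k (h⁻¹ • p) := by
  simp only [scaledKernel, Prod.smul_def, smul_eq_mul, div_eq_inv_mul]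

theorem continuous_scaledKernel (hk : Continuous k) (h : ℝ) : Continuous (scaledKernel k h) := by
  unfold scaledKernel
  fun_prop

theorem scaledKernel_norm_le (hh : 0 < h) {R : ℝ} (hR : ∀ p, k p ≠ 0 → ‖p‖ ≤ R) (p : ℝ × ℝ)
    (hp : scaledKernel k h p ≠ 0) : ‖p‖ ≤ R * h := by
  rw [scaledKernel_eq_smul] at hp
  have := hR _ (right_ne_zero_of_mul hp)
  rwa [norm_smul, norm_inv, Real.norm_of_nonneg hh.le, inv_mul_le_iff₀ hh, mul_comm] at this

theorem hasCompactSupport_scaledKernel (hk : HasCompactSupport k) (hh : 0 < h) :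
    HasCompactSupport (scaledKernel k h) := by
  have h1 : scaledKernel k h = fun p => 1 / h ^ 2 * k (h⁻¹ • p) :=
    funext (scaledKernel_eq_smul k h)
  rw [h1]
  exact HasCompactSupport.mul_left (hk.comp_smul (inv_ne_zero hh.ne'))

theorem isTestFunction_scaledKernel (hk : IsTestFunction k) (hh : 0 < h) :
    IsTestFunction (scaledKernel k h) := by
  refine ⟨?_, hasCompactSupport_scaledKernel hk.2 hh⟩
  have h1 : scaledKernel k h = fun p => 1 / h ^ 2 * k (h⁻¹ • p) :=
    funext (scaledKernel_eq_smul k h)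
  rw [h1]
  exact contDiff_const.mul (hk.1.comp (contDiff_const_smul _))

theorem integral_scaledKernel (k : ℝ × ℝ → ℝ) (hh : 0 < h) :
    ∫ p, scaledKernel k h p = ∫ p, k p := by
  simp_rw [scaledKernel_eq_smul]
  rw [integral_const_mul, Measure.integral_comp_inv_smul]
  simp
  field_simp

theorem abs_scaledKernel (k : ℝ × ℝ → ℝ) (h : ℝ) (p : ℝ × ℝ) :
    |scaledKernel k h p| = scaledKernel (fun q => |k q|) h p := by
  simp only [scaledKernel, abs_mul]
  rw [abs_of_nonneg (by positivity)]

theorem integral_abs_scaledKernel (k : ℝ × ℝ → ℝ) (hh : 0 < h) :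
    ∫ p, |scaledKernel k h p| = ∫ p, |k p| := by
  simp_rw [abs_scaledKernel]
  exact integral_scaledKernel _ hh

theorem partialX_scaledKernel (hk : IsTestFunction k) (h : ℝ) :
    partialX (scaledKernel k h) = fun p => 1 / h * scaledKernel (partialX k) h p := by
  funext p
  have h1 : HasDerivAt (fun s : ℝ => k (s, p.2 / h)) (partialX k (p.1 / h, p.2 / h)) (p.1 / h) := by
    have hd : DifferentiableAt ℝ (fun s : ℝ => k (s, p.2 / h)) (p.1 / h) :=
      (hk.differentiable _).comp _ (by fun_prop)
    exact hd.hasDerivAt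
  have h2 := (h1.comp p.1 ((hasDerivAt_id p.1).div_const h)).const_mul (1 / h ^ 2)
  rw [partialX]
  refine HasDerivAt.deriv (h2.congr_deriv ?_)
  simp only [scaledKernel]
  ring

theorem partialY_scaledKernel (hk : IsTestFunction k) (h : ℝ) :
    partialY (scaledKernel k h) = fun p => 1 / h * scaledKernel (partialY k) h p := by
  funext p
  have h1 : HasDerivAt (fun s : ℝ => k (p.1 / h, s)) (partialY k (p.1 / h, p.2 / h)) (p.2 / h) := by
    have hd : DifferentiableAt ℝ (fun s : ℝ => k (p.1 / h, s)) (p.2 / h) :=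
      (hk.differentiable _).comp _ (by fun_prop)
    exact hd.hasDerivAt
  have h2 := (h1.comp p.2 ((hasDerivAt_id p.2).div_const h)).const_mul (1 / h ^ 2)
  rw [partialY]
  refine HasDerivAt.deriv (h2.congr_deriv ?_)
  simp only [scaledKernel]
  ring

/-- The scaled kernel is bounded by `c / h ^ 2` and, since `h ≤ 1`, supported in a ball of fixed
radius `R`, which meets a bounded number of period squares. -/
theorem exists_abs_planeConv_scaledKernel_le (hk : Continuous k) (hk' : HasCompactSupport k) :
    ∃ C : ℝ, 0 ≤ C ∧ ∀ h : ℝ, 0 < h → h ≤ 1 → ∀ f : ℝ × ℝ → ℝ, IsTorusPeriodic f →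
      Continuous f → ∀ p, |planeConv f (scaledKernel k h) p| ≤ C * torusL1 f / h ^ 2 := by
  obtain ⟨R, hR0, hR⟩ := hk'.exists_radius
  obtain ⟨n, hn, hball⟩ := exists_setIntegral_closedBall_le R
  obtain ⟨c, hc⟩ := hk.bounded_above_of_compact_support hk'
  have hc0 : 0 ≤ c := (norm_nonneg _).trans (hc 0)
  refine ⟨c * n, by positivity, fun h hh hh1 f hp hf p => ?_⟩
  have hb : MeasurableSet (Metric.closedBall p R) := measurableSet_closedBall
  have h1 : |planeConv f (scaledKernel k h) p| ≤
      ∫ q in Metric.closedBall p R, c / h ^ 2 * |f q| := by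
    rw [planeConv_apply, ← integral_indicator hb]
    refine abs_integral_le_of_abs_le ((integrable_indicator_iff hb).2
      ((hf.abs.const_mul _).continuousOn.integrableOn_compact (isCompact_closedBall _ _)))
      fun q => ?_
    by_cases h0 : scaledKernel k h (p - q) = 0
    · rw [h0, mul_zero, abs_zero]
      exact indicator_nonneg (fun _ _ => by positivity) _
    · have hq : q ∈ Metric.closedBall p R := by
        rw [mem_closedBall_iff_norm']
        exact (scaledKernel_norm_le hh hR _ h0).trans (mul_le_of_le_one_right hR0 hh1)
      rw [indicator_of_mem hq, abs_mul, mul_comm, scaledKernel_eq_smul, abs_mul,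
        abs_of_nonneg (by positivity : (0 : ℝ) ≤ 1 / h ^ 2),
        div_eq_mul_one_div c, mul_comm c]
      gcongr
      exact hc _
  refine h1.trans ?_
  rw [integral_const_mul]
  calc _ ≤ c / h ^ 2 * (n * torusL1 f) := by gcongr; exact hball f hp hf p
    _ = _ := by ring

end ScaledKernel

/-! ### The upwind operator: solvability and `L¹` stability. -/

section Upwind

/-- Translation by `a` on the bounded continuous functions on the plane. -/
noncomputable def shiftCLM (a : ℝ × ℝ) : (ℝ × ℝ →ᵇ ℝ) →L[ℝ] (ℝ × ℝ →ᵇ ℝ) :=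
  LinearMap.mkContinuous
    { toFun := fun f => f.compContinuous ⟨fun p => p + a, by fun_prop⟩
      map_add' := fun _ _ => rfl
      map_smul' := fun _ _ => rfl }
    1 (fun f => by
      rw [one_mul]
      exact (BoundedContinuousFunction.norm_le (norm_nonneg _)).2 fun p => f.norm_coe_le_norm _)

@[simp]
theorem shiftCLM_apply (a : ℝ × ℝ) (f : ℝ × ℝ →ᵇ ℝ) (p : ℝ × ℝ) : shiftCLM a f p = f (p + a) := rfl

theorem norm_shiftCLM_le (a : ℝ × ℝ) : ‖shiftCLM a‖ ≤ 1 :=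
  LinearMap.mkContinuous_norm_le _ zero_le_one _

/-- The four directions into which mass is transported. -/
def upwindDir : Fin 4 → ℝ × ℝ := ![(1, 0), (-1, 0), (0, 1), (0, -1)]

/-- The speeds `u⁺`, `u⁻`, `v⁺`, `v⁻` in the four directions. -/
noncomputable def upwindWeight (u v : ℝ × ℝ →ᵇ ℝ) : Fin 4 → (ℝ × ℝ →ᵇ ℝ) :=
  ![0 ⊔ u, 0 ⊔ -u, 0 ⊔ v, 0 ⊔ -v]

theorem upwindWeight_apply (u v : ℝ × ℝ →ᵇ ℝ) (i : Fin 4) (p : ℝ × ℝ) :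
    upwindWeight u v i p = ![max 0 (u p), max 0 (-u p), max 0 (v p), max 0 (-v p)] i := by
  fin_cases i <;> rfl

theorem upwindWeight_nonneg (u v : ℝ × ℝ →ᵇ ℝ) (i : Fin 4) (p : ℝ × ℝ) :
    0 ≤ upwindWeight u v i p := by
  rw [upwindWeight_apply]
  fin_cases i <;> exact le_max_left _ _

theorem sum_upwindWeight (u v : ℝ × ℝ →ᵇ ℝ) (p : ℝ × ℝ) :
    ∑ i, upwindWeight u v i p = |u p| + |v p| := by
  have h : ∀ x : ℝ, max 0 x + max 0 (-x) = |x| := fun x => by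
    rcases le_total 0 x with h | h
    · rw [max_eq_right h, max_eq_left (by linarith), abs_of_nonneg h, add_zero]
    · rw [max_eq_left h, max_eq_right (by linarith), abs_of_nonpos h, zero_add]
  simp only [upwindWeight_apply, Fin.sum_univ_four]
  rw [← h, ← h, ← add_assoc]
  rfl

theorem upwindWeight_le (u v : ℝ × ℝ →ᵇ ℝ) (i : Fin 4) (p : ℝ × ℝ) :
    upwindWeight u v i p ≤ |u p| + |v p| := by
  rw [← sum_upwindWeight]
  exact Finset.single_le_sum (f := fun i => upwindWeight u v i p)
    (fun j _ => upwindWeight_nonneg u v j p) (Finset.mem_univ i)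

theorem norm_upwindWeight_le (u v : ℝ × ℝ →ᵇ ℝ) (i : Fin 4) :
    ‖upwindWeight u v i‖ ≤ ‖u‖ + ‖v‖ := by
  refine (BoundedContinuousFunction.norm_le (by positivity)).2 fun p => ?_
  rw [Real.norm_of_nonneg (upwindWeight_nonneg u v i p)]
  exact (upwindWeight_le u v i p).trans
    (add_le_add (u.norm_coe_le_norm p) (v.norm_coe_le_norm p))

theorem isTorusPeriodic_upwindWeight {u v : ℝ × ℝ →ᵇ ℝ} (hu : IsTorusPeriodic u)
    (hv : IsTorusPeriodic v) (i : Fin 4) : IsTorusPeriodic (upwindWeight u v i) := fun x y => by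
  simp only [upwindWeight_apply, (hu x y).1, (hu x y).2, (hv x y).1, (hv x y).2, and_self]

theorem continuousOn_upwindWeight {u v : ℝ → (ℝ × ℝ →ᵇ ℝ)} {s : Set ℝ} (hu : ContinuousOn u s)
    (hv : ContinuousOn v s) (i : Fin 4) : ContinuousOn (fun t => upwindWeight (u t) (v t) i) s := by
  fin_cases i
  · exact continuousOn_const.sup hu
  · exact continuousOn_const.sup hu.neg
  · exact continuousOn_const.sup hv
  · exact continuousOn_const.sup hv.neg

/-- The upwind discretization as an operator on the bounded continuous functions. -/
noncomputable def upwindCLM (ε : ℝ) (u v : ℝ × ℝ →ᵇ ℝ) : (ℝ × ℝ →ᵇ ℝ) →L[ℝ] (ℝ × ℝ →ᵇ ℝ) :=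
  (1 / ε) • ∑ i, (shiftCLM (-(ε • upwindDir i)) - ContinuousLinearMap.id ℝ _) ∘L
    ContinuousLinearMap.mul ℝ (ℝ × ℝ →ᵇ ℝ) (upwindWeight u v i)

theorem upwindCLM_apply (ε : ℝ) (u v X : ℝ × ℝ →ᵇ ℝ) (p : ℝ × ℝ) :
    upwindCLM ε u v X p = 1 / ε * ∑ i, ((X * upwindWeight u v i) (p - ε • upwindDir i) -
      (X * upwindWeight u v i) p) := by
  simp [upwindCLM, sub_eq_add_neg, mul_comm, BoundedContinuousFunction.coe_sum]

/-- The four outgoing terms add up to `X (|u| + |v|)`, because positive and negative parts sum to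
the absolute value. This identifies the conservative form with the given scheme. -/
theorem upwindCLM_eq_upwind (ε : ℝ) (u v X : ℝ × ℝ →ᵇ ℝ) (p : ℝ × ℝ) :
    upwindCLM ε u v X p = upwind ε u v X p := by
  have hs := sum_upwindWeight u v p
  rw [upwindCLM_apply, upwind, Finset.sum_sub_distrib]
  simp only [BoundedContinuousFunction.coe_mul, Pi.mul_apply, ← Finset.mul_sum, hs]
  obtain ⟨x, y⟩ := p
  simp only [upwindWeight_apply, Fin.sum_univ_four]
  simp [upwindDir, sub_eq_add_neg, -mul_eq_mul_left_iff]
  ring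

theorem norm_upwindCLM_le {ε : ℝ} (hε : 0 < ε) (u v : ℝ × ℝ →ᵇ ℝ) :
    ‖upwindCLM ε u v‖ ≤ 1 / ε * (8 * (‖u‖ + ‖v‖)) := by
  refine (ContinuousLinearMap.opNorm_smul_le _ _).trans ?_
  rw [Real.norm_of_nonneg (by positivity)]
  gcongr
  refine (norm_sum_le_of_le (f := fun i => (shiftCLM (-(ε • upwindDir i)) -
    ContinuousLinearMap.id ℝ _) ∘L ContinuousLinearMap.mul ℝ (ℝ × ℝ →ᵇ ℝ) (upwindWeight u v i))
    (n := fun _ => 2 * (‖u‖ + ‖v‖)) _ fun i _ => ?_).trans (le_of_eq ?_)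
  · refine (ContinuousLinearMap.opNorm_comp_le _ _).trans (mul_le_mul ?_ ?_ (norm_nonneg _)
      zero_le_two)
    · refine (norm_sub_le _ _).trans ?_
      linarith [norm_shiftCLM_le (-(ε • upwindDir i)),
        ContinuousLinearMap.norm_id_le (𝕜 := ℝ) (E := ℝ × ℝ →ᵇ ℝ)]
    · exact (ContinuousLinearMap.opNorm_mul_apply_le ℝ _ _).trans (norm_upwindWeight_le u v i)
  · simp
    ring

theorem continuousOn_upwindCLM (ε : ℝ) {u v : ℝ → (ℝ × ℝ →ᵇ ℝ)} {s : Set ℝ}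
    (hu : ContinuousOn u s) (hv : ContinuousOn v s) :
    ContinuousOn (fun t => upwindCLM ε (u t) (v t)) s := by
  have h : ContinuousOn (fun t => ∑ i, (shiftCLM (-(ε • upwindDir i)) -
      ContinuousLinearMap.id ℝ _) ∘L ContinuousLinearMap.mul ℝ (ℝ × ℝ →ᵇ ℝ)
        (upwindWeight (u t) (v t) i)) s := by
    refine continuousOn_finsetSum _ fun i _ => ?_
    exact continuousOn_const.clm_comp ((ContinuousLinearMap.mul ℝ _).continuous.comp_continuousOn
      (continuousOn_upwindWeight hu hv i))
  exact h.const_smul (1 / ε)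

/-- Translating a solution by a common period of the velocities thus gives a solution of the
translated problem; periodicity will follow from uniqueness. -/
theorem shiftCLM_upwindCLM {ε : ℝ} {u v : ℝ × ℝ →ᵇ ℝ} {a : ℝ × ℝ} (hu : ∀ p, u (p + a) = u p)
    (hv : ∀ p, v (p + a) = v p) (X : ℝ × ℝ →ᵇ ℝ) :
    shiftCLM a (upwindCLM ε u v X) = upwindCLM ε u v (shiftCLM a X) := by
  ext p
  simp only [shiftCLM_apply, upwindCLM_apply, BoundedContinuousFunction.coe_mul, Pi.mul_apply,
    upwindWeight_apply, hu, hv, add_sub_right_comm]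

theorem isUpwindSolution_iff {ε : ℝ} {u v : ℝ → (ℝ × ℝ →ᵇ ℝ)} {S : ℝ → ℝ × ℝ → ℝ}
    {b : ℝ → (ℝ × ℝ →ᵇ ℝ)} (hS : ∀ t, 0 ≤ t → ∀ p, S t p = b t p) {X₀ : ℝ × ℝ →ᵇ ℝ}
    {X : ℝ → (ℝ × ℝ →ᵇ ℝ)} :
    IsUpwindSolution ε u v S X₀ X ↔ X 0 = X₀ ∧ ∀ t, 0 ≤ t →
      HasDerivWithinAt X (upwindCLM ε (u t) (v t) (X t) + b t) (Ici 0) t := by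
  refine and_congr_right fun _ => forall₂_congr fun t ht => ⟨?_, fun h => ⟨_, fun p => ?_, h⟩⟩
  · rintro ⟨D, hD, h⟩
    convert h
    ext p
    rw [hD, hS t ht, BoundedContinuousFunction.add_apply, upwindCLM_eq_upwind]
  · rw [hS t ht, BoundedContinuousFunction.add_apply, upwindCLM_eq_upwind]

/-- Existence, uniqueness and periodicity for the upwind ODE. -/
theorem exists_isUniqueUpwindSolution {ε : ℝ} (hε : 0 < ε) {u v : ℝ → (ℝ × ℝ →ᵇ ℝ)}
    (hu : ContinuousOn u (Ici 0)) (hv : ContinuousOn v (Ici 0)) {M : ℝ}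
    (hMu : ∀ t, 0 ≤ t → ‖u t‖ ≤ M) (hMv : ∀ t, 0 ≤ t → ‖v t‖ ≤ M)
    (hpu : ∀ t, 0 ≤ t → IsTorusPeriodic (u t)) (hpv : ∀ t, 0 ≤ t → IsTorusPeriodic (v t))
    {b : ℝ → (ℝ × ℝ →ᵇ ℝ)} (hb : ContinuousOn b (Ici 0)) {B : ℝ} (hB : ∀ t, 0 ≤ t → ‖b t‖ ≤ B)
    (hpb : ∀ t, 0 ≤ t → IsTorusPeriodic (b t))
    {X₀ : ℝ × ℝ →ᵇ ℝ} (hp0 : IsTorusPeriodic X₀) :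
    ∃ X : ℝ → (ℝ × ℝ →ᵇ ℝ), (∀ S : ℝ → ℝ × ℝ → ℝ, (∀ t, 0 ≤ t → ∀ p, S t p = b t p) →
      IsUniqueUpwindSolution ε u v S X₀ X) ∧ ∀ t, 0 ≤ t → IsTorusPeriodic (X t) := by
  have hK : ∀ t, 0 ≤ t → ‖upwindCLM ε (u t) (v t)‖ ≤ 1 / ε * (8 * (M + M)) := fun t ht =>
    (norm_upwindCLM_le hε _ _).trans (by gcongr; exacts [hMu t ht, hMv t ht])
  obtain ⟨X, hX0, hX⟩ := exists_solution_linearODE (continuousOn_upwindCLM ε hu hv) hb hK hB X₀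
  refine ⟨X, fun S hS => ⟨(isUpwindSolution_iff hS).2 ⟨hX0, hX⟩, fun Y hY t ht => ?_⟩, ?_⟩
  · obtain ⟨hY0, hY⟩ := (isUpwindSolution_iff hS).1 hY
    exact linearODE_unique hK hY hX (hY0.trans hX0.symm) ht
  -- If all data are invariant under `a`, the translate of `X` solves the same initial value
  -- problem, hence equals `X`.
  · have hinv : ∀ a : ℝ × ℝ, (∀ t, 0 ≤ t → ∀ p, u t (p + a) = u t p) →
        (∀ t, 0 ≤ t → ∀ p, v t (p + a) = v t p) → (∀ t, 0 ≤ t → ∀ p, b t (p + a) = b t p) →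
        (∀ p, X₀ (p + a) = X₀ p) → ∀ t, 0 ≤ t → ∀ p, X t (p + a) = X t p := by
      intro a hau hav hab ha0 t ht p
      have h1 : ∀ t, 0 ≤ t → HasDerivWithinAt (fun t => shiftCLM a (X t))
          (upwindCLM ε (u t) (v t) (shiftCLM a (X t)) + b t) (Ici 0) t := by
        intro t ht
        have h2 := (shiftCLM a).hasFDerivAt.comp_hasDerivWithinAt t (hX t ht)
        have h3 : shiftCLM a (b t) = b t := by ext p; exact hab t ht p
        rwa [map_add, shiftCLM_upwindCLM (hau t ht) (hav t ht), h3] at h2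
      have h4 := linearODE_unique hK h1 hX (by rw [hX0]; ext p; exact ha0 p) ht
      exact DFunLike.congr_fun h4 p
    intro t ht
    rw [isTorusPeriodic_iff]
    refine ⟨hinv _ (fun t ht => (isTorusPeriodic_iff.1 (hpu t ht)).1)
      (fun t ht => (isTorusPeriodic_iff.1 (hpv t ht)).1)
      (fun t ht => (isTorusPeriodic_iff.1 (hpb t ht)).1) (isTorusPeriodic_iff.1 hp0).1 t ht,
      hinv _ (fun t ht => (isTorusPeriodic_iff.1 (hpu t ht)).2)
      (fun t ht => (isTorusPeriodic_iff.1 (hpv t ht)).2)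
      (fun t ht => (isTorusPeriodic_iff.1 (hpb t ht)).2) (isTorusPeriodic_iff.1 hp0).2 t ht⟩

/-- An explicit Euler step of small length does not increase the `L¹` norm. -/
theorem torusL1_euler_le {ε h : ℝ} (hε : 0 < ε) (hh : 0 ≤ h) {u v X : ℝ × ℝ →ᵇ ℝ}
    (hu : IsTorusPeriodic u) (hv : IsTorusPeriodic v) (hX : IsTorusPeriodic X)
    (hsmall : h / ε * (‖u‖ + ‖v‖) ≤ 1) :
    torusL1 ⇑(X + h • upwindCLM ε u v X) ≤ torusL1 X := by
  set H : Fin 4 → ℝ × ℝ → ℝ := fun i p => |X p| * upwindWeight u v i p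
  have hHc : ∀ i, Continuous (H i) := fun i => by
    have := (upwindWeight u v i).continuous
    fun_prop
  have hHp : ∀ i, IsTorusPeriodic (H i) := fun i =>
    (hX.comp abs).mul (isTorusPeriodic_upwindWeight hu hv i)
  -- Here `c` is the fraction of mass leaving `p` in one step. The condition `hsmall` makes `1 - c`
  -- nonnegative, so the triangle inequality loses nothing on the diagonal term, and the remaining
  -- sum has zero integral over a period.
  have hpt : ∀ p, |(X + h • upwindCLM ε u v X) p| ≤
      |X p| + h / ε * ∑ i, (H i (p + -(ε • upwindDir i)) - H i p) := by
    intro p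
    set c := h / ε * ∑ i, upwindWeight u v i p
    have hc : 0 ≤ 1 - c := by
      have : c ≤ h / ε * (‖u‖ + ‖v‖) := by
        simp only [c, sum_upwindWeight]
        gcongr
        exacts [u.norm_coe_le_norm p, v.norm_coe_le_norm p]
      linarith
    have h1 : (X + h • upwindCLM ε u v X) p = (1 - c) * X p + h / ε *
        ∑ i, (X * upwindWeight u v i) (p + -(ε • upwindDir i)) := by
      rw [BoundedContinuousFunction.add_apply, BoundedContinuousFunction.smul_apply,
        upwindCLM_apply, Finset.sum_sub_distrib, smul_eq_mul]
      simp only [BoundedContinuousFunction.coe_mul, Pi.mul_apply, ← Finset.mul_sum, c,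
        sub_eq_add_neg]
      ring
    have h2 : |∑ i, (X * upwindWeight u v i) (p + -(ε • upwindDir i))| ≤
        ∑ i, H i (p + -(ε • upwindDir i)) := by
      refine (Finset.abs_sum_le_sum_abs _ _).trans (le_of_eq (Finset.sum_congr rfl fun i _ => ?_))
      simp only [BoundedContinuousFunction.coe_mul, Pi.mul_apply, H]
      rw [abs_mul, abs_of_nonneg (upwindWeight_nonneg u v i _)]
    have h3 : 0 ≤ h / ε := by positivity
    rw [h1]
    refine (abs_add_le _ _).trans ?_
    rw [abs_mul, abs_mul, abs_of_nonneg hc, abs_of_nonneg h3, Finset.sum_sub_distrib]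
    have h4 : ∑ i, H i p = |X p| * ∑ i, upwindWeight u v i p := (Finset.mul_sum _ _ _).symm
    rw [h4]
    have h5 := mul_le_mul_of_nonneg_left h2 h3
    simp only [c]
    nlinarith
  have hi : ∀ {f : ℝ × ℝ → ℝ}, Continuous f → IntegrableOn f torusBox := fun hf =>
    hf.continuousOn.integrableOn_compact isCompact_torusBox
  have hs : ∀ i, Continuous fun p => H i (p + -(ε • upwindDir i)) := fun i =>
    (hHc i).comp (by fun_prop)
  have hsum : Continuous fun p => ∑ i, (H i (p + -(ε • upwindDir i)) - H i p) :=
    continuous_finsetSum _ fun i _ => (hs i).sub (hHc i)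
  have hsum' : Continuous fun p => h / ε * ∑ i, (H i (p + -(ε • upwindDir i)) - H i p) :=
    continuous_const.mul hsum
  calc torusL1 ⇑(X + h • upwindCLM ε u v X)
      ≤ ∫ p in torusBox, (|X p| + h / ε * ∑ i, (H i (p + -(ε • upwindDir i)) - H i p)) :=
        setIntegral_mono (hi (X + h • upwindCLM ε u v X).continuous.abs)
          (hi (X.continuous.abs.add hsum')) hpt
    _ = torusL1 X + h / ε * ∑ i, ((∫ p in torusBox, H i (p + -(ε • upwindDir i))) -
          ∫ p in torusBox, H i p) := by
        rw [integral_add (hi X.continuous.abs) (hi hsum'),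
          integral_const_mul, integral_finsetSum
            (f := fun i p => H i (p + -(ε • upwindDir i)) - H i p) _
            fun i _ => (hi (hs i)).sub (hi (hHc i))]
        congr 2
        exact Finset.sum_congr rfl fun i _ => integral_sub (hi (hs i)) (hi (hHc i))
    _ = torusL1 X := by
        have h0 : ∀ i, (∫ p in torusBox, H i (p + -(ε • upwindDir i))) = ∫ p in torusBox, H i p :=
          fun i => (hHp i).integral_add (hHc i) _
        simp only [h0, sub_self, Finset.sum_const_zero, mul_zero,
          add_zero]

theorem torusL1_le_norm (f : ℝ × ℝ →ᵇ ℝ) : torusL1 f ≤ (2 * Real.pi) ^ 2 * ‖f‖ := by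
  have h := torusL1_mono f.continuous (continuous_const (y := ‖f‖))
    (fun p => by rw [abs_norm]; exact f.norm_coe_le_norm p)
  rwa [torusL1_const, abs_norm] at h

theorem torusL1_sub_le (f g : ℝ × ℝ →ᵇ ℝ) :
    torusL1 f ≤ torusL1 g + (2 * Real.pi) ^ 2 * ‖f - g‖ := by
  have h := torusL1_add_le g.continuous (f - g).continuous
  have h2 : (fun p => g p + (f - g) p) = f := by
    funext p
    simp
  rw [h2] at h
  linarith [torusL1_le_norm (f - g)]

theorem continuous_torusL1 : Continuous fun f : ℝ × ℝ →ᵇ ℝ => torusL1 f := by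
  refine (LipschitzWith.of_le_add_mul (Real.toNNReal ((2 * Real.pi) ^ 2)) fun f g => ?_).continuous
  rw [Real.coe_toNNReal _ (by positivity), dist_eq_norm]
  exact torusL1_sub_le f g

/-- The `L¹` norm of a solution grows at most linearly, with the rate given by the source. -/
theorem torusL1_solution_le {ε : ℝ} (hε : 0 < ε) {u v : ℝ → (ℝ × ℝ →ᵇ ℝ)} {M : ℝ}
    (hMu : ∀ t, 0 ≤ t → ‖u t‖ ≤ M) (hMv : ∀ t, 0 ≤ t → ‖v t‖ ≤ M)
    (hpu : ∀ t, 0 ≤ t → IsTorusPeriodic (u t)) (hpv : ∀ t, 0 ≤ t → IsTorusPeriodic (v t))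
    {b : ℝ → (ℝ × ℝ →ᵇ ℝ)} {B : ℝ} (hB : ∀ t, 0 ≤ t → ‖b t‖ ≤ B) {X : ℝ → (ℝ × ℝ →ᵇ ℝ)}
    (hpX : ∀ t, 0 ≤ t → IsTorusPeriodic (X t))
    (hX : ∀ t, 0 ≤ t →
      HasDerivWithinAt X (upwindCLM ε (u t) (v t) (X t) + b t) (Ici 0) t)
    {t : ℝ} (ht : 0 ≤ t) :
    torusL1 (X t) ≤ torusL1 (X 0) + (2 * Real.pi) ^ 2 * B * t := by
  set A := (2 * Real.pi) ^ 2 with hA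
  have hA0 : 0 < A := by have := Real.pi_pos; positivity
  have hM0 : 0 ≤ M := (norm_nonneg _).trans (hMu 0 le_rfl)
  -- The norm need not be differentiable in time, so its right slopes are compared with the constant
  -- slope `A * B` of the bound.
  refine image_le_of_liminf_slope_right_le_deriv_boundary (f := fun t => torusL1 (X t))
    (B := fun t => torusL1 (X 0) + A * B * t) (B' := fun _ => A * B) (a := 0) (b := t)
    (continuous_torusL1.comp_continuousOn fun s hs =>
      (hX s hs.1).continuousWithinAt.mono Icc_subset_Ici_self) (by simp) (by fun_prop)
    (fun s _ => ?_) (fun s hs r hr => ?_) ⟨ht, le_rfl⟩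
  · simpa using (((hasDerivWithinAt_id s (Ici s)).const_mul (A * B)).const_add (torusL1 (X 0)))
  · have hd := (hX s hs.1).mono (Ioi_subset_Ici hs.1)
    set D := upwindCLM ε (u s) (v s) (X s) with hD
    rw [hasDerivWithinAt_iff_isLittleO] at hd
    -- Half of the gap `r - A * B` is spent on the differentiation remainder; `A` is the area of the
    -- torus, which converts sup norms into `L¹` norms.
    have hη : 0 < (r - A * B) / (2 * A) := div_pos (by linarith) (by positivity)
    have h1 := hd.def hη
    -- For `z` close to `s` the Euler step of length `z - s` satisfies the smallness condition of
    -- `torusL1_euler_le`.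
    have h2 : ∀ᶠ z in 𝓝[>] s, (z - s) / ε * (M + M) < 1 := by
      have : Tendsto (fun z => (z - s) / ε * (M + M)) (𝓝[>] s) (𝓝 ((s - s) / ε * (M + M))) :=
        (Continuous.tendsto (by fun_prop) s).mono_left nhdsWithin_le_nhds
      exact this.eventually_lt_const (by simp)
    refine Eventually.frequently ?_
    filter_upwards [h1, h2, self_mem_nhdsWithin] with z hz1 hz2 hz3
    have hzs : 0 < z - s := sub_pos.2 hz3
    rw [Real.norm_of_nonneg hzs.le] at hz1
    have h3 : torusL1 ⇑(X s + (z - s) • D) ≤ torusL1 (X s) :=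
      torusL1_euler_le hε hzs.le (hpu s hs.1) (hpv s hs.1) (hpX s hs.1)
        (le_trans (by gcongr; exacts [hMu s hs.1, hMv s hs.1]) hz2.le)
    have h4 := torusL1_sub_le (X z) (X s + (z - s) • D)
    have h5 : ‖X z - (X s + (z - s) • D)‖ ≤ (r - A * B) / (2 * A) * (z - s) + (z - s) * B := by
      have : X z - (X s + (z - s) • D) = (X z - X s - (z - s) • (D + b s)) + (z - s) • b s := by
        rw [smul_add]
        abel
      rw [this]
      refine (norm_add_le _ _).trans (add_le_add hz1 ?_)
      rw [norm_smul, Real.norm_of_nonneg hzs.le]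
      gcongr
      exact hB s hs.1
    have h6 : torusL1 (X z) - torusL1 (X s) ≤ (r - A * B) / 2 * (z - s) + A * B * (z - s) := by
      have h7 := mul_le_mul_of_nonneg_left h5 hA0.le
      have h8 : A * ((r - A * B) / (2 * A) * (z - s) + (z - s) * B) =
          (r - A * B) / 2 * (z - s) + A * B * (z - s) := by
        field_simp
      linarith
    rw [slope_def_field, div_lt_iff₀ hzs]
    nlinarith

end Upwind

/-! ### Weak consistency of the scheme and commutator estimates. -/

section Consistency

/-- The derivative of `ψ` is Lipschitz, being smooth with compact support; the mean value inequality
on the ball of radius `‖e‖` supplies the second factor `‖e‖`. -/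
theorem IsTestFunction.exists_taylor_bound {ψ : ℝ × ℝ → ℝ} (hψ : IsTestFunction ψ) :
    ∃ C : ℝ, 0 ≤ C ∧ ∀ p e, |ψ (p + e) - ψ p - fderiv ℝ ψ p e| ≤ C * ‖e‖ ^ 2 := by
  obtain ⟨C, hC⟩ : ∃ C, LipschitzWith C (fderiv ℝ ψ) :=
    ContDiff.lipschitzWith_of_hasCompactSupport (hψ.2.fderiv ℝ)
      (hψ.1.fderiv_right (m := 1) (WithTop.coe_le_coe.2 le_top)) one_ne_zero
  refine ⟨C, C.2, fun p e => ?_⟩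
  have h := (convex_closedBall p ‖e‖).norm_image_sub_le_of_norm_fderiv_le' (𝕜 := ℝ) (f := ψ)
    (φ := fderiv ℝ ψ p) (C := C * ‖e‖) (x := p) (y := p + e) (fun x _ => hψ.differentiable x)
    (fun x hx => by
      have h1 := hC.dist_le_mul x p
      rw [dist_eq_norm] at h1
      exact h1.trans (mul_le_mul_of_nonneg_left (Metric.mem_closedBall.1 hx) C.2))
    (Metric.mem_closedBall_self (norm_nonneg e)) (by simp [Metric.mem_closedBall])
  rw [add_sub_cancel_left, Real.norm_eq_abs] at h
  linarith

theorem abs_integral_le_closedBall {f g : ℝ × ℝ → ℝ} {c R : ℝ} (hg : LocallyIntegrable g)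
    (h : ∀ p, |f p| ≤ c * |g p|) (h0 : ∀ p, f p ≠ 0 → ‖p‖ ≤ R) :
    |∫ p, f p| ≤ c * ∫ p in Metric.closedBall 0 R, |g p| := by
  have hb : MeasurableSet (Metric.closedBall (0 : ℝ × ℝ) R) := measurableSet_closedBall
  rw [← integral_const_mul, ← integral_indicator hb]
  refine abs_integral_le_of_abs_le ((integrable_indicator_iff hb).2
    ((hg.integrableOn_isCompact (isCompact_closedBall _ _)).abs.const_mul c))
    fun p => ?_
  by_cases hp : f p = 0
  · by_cases hq : p ∈ Metric.closedBall (0 : ℝ × ℝ) R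
    · rw [indicator_of_mem hq]
      exact h p
    · rw [indicator_of_notMem hq, hp, abs_zero]
  · rw [indicator_of_mem (mem_closedBall_zero_iff.2 (h0 p hp))]
    exact h p

/-- Consistency of the one-sided difference quotient in the direction `e`, in the weak sense. -/
theorem IsTestFunction.exists_difference_bound {ψ : ℝ × ℝ → ℝ} (hψ : IsTestFunction ψ) :
    ∃ C R : ℝ, 0 ≤ C ∧ ∀ ε : ℝ, 0 < ε → ε ≤ 1 → ∀ e : ℝ × ℝ, ‖e‖ ≤ 1 → ∀ f : ℝ × ℝ → ℝ,
      Continuous f → |∫ p, (1 / ε * (f (p - ε • e) - f p) * ψ p - f p * fderiv ℝ ψ p e)| ≤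
        C * ε * ∫ p in Metric.closedBall 0 R, |f p| := by
  obtain ⟨C, hC0, hC⟩ := hψ.exists_taylor_bound
  obtain ⟨R, hR0, hR⟩ := hψ.2.exists_radius
  obtain ⟨R', -, hR'⟩ := (hψ.2.fderiv ℝ).isCompact.isBounded.subset_closedBall_lt 0 0
  -- The shifted test function moves by at most `ε ≤ 1`, hence `R + 1`; `R'` covers the support of
  -- the derivative.
  refine ⟨C, max (R + 1) R', hC0, fun ε hε hε1 e he f hf => ?_⟩
  have hψc := hψ.1.continuous
  have hεe : ‖ε • e‖ ≤ ε := by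
    rw [norm_smul, Real.norm_of_nonneg hε.le]
    exact mul_le_of_le_one_right hε.le he
  have hψs : HasCompactSupport fun p => ψ (p + ε • e) :=
    hψ.2.comp_homeomorph (Homeomorph.addRight (ε • e))
  have i1 : Integrable fun p => f (p - ε • e) * ψ p :=
    Continuous.integrable_of_hasCompactSupport (by fun_prop) hψ.2.mul_left
  have i2 : Integrable fun p => f p * ψ p :=
    Continuous.integrable_of_hasCompactSupport (by fun_prop) hψ.2.mul_left
  have i3 : Integrable fun p => f p * fderiv ℝ ψ p e :=
    Continuous.integrable_of_hasCompactSupport (hf.mul (hψ.continuous_fderiv_apply e))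
      (hψ.hasCompactSupport_fderiv_apply e).mul_left
  have i4 : Integrable fun p => f p * ψ (p + ε • e) :=
    Continuous.integrable_of_hasCompactSupport (by fun_prop) hψs.mul_left
  have i5 : Integrable fun p => f (p - ε • e) * ψ p - f p * ψ p := i1.sub i2
  have i6 : Integrable fun p => f p * ψ (p + ε • e) - f p * ψ p := i4.sub i2
  -- Discrete integration by parts: the translation passes to `ψ`, so no regularity of `f` beyond
  -- continuity is needed.
  have h1 : ∫ p, f (p - ε • e) * ψ p = ∫ p, f p * ψ (p + ε • e) := by
    rw [← integral_add_right_eq_self (fun p => f (p - ε • e) * ψ p) (ε • e)]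
    simp
  have h2 : ∫ p, (1 / ε * (f (p - ε • e) - f p) * ψ p - f p * fderiv ℝ ψ p e) =
      ∫ p, f p * (1 / ε * (ψ (p + ε • e) - ψ p) - fderiv ℝ ψ p e) := by
    calc _ = ∫ p, (1 / ε * (f (p - ε • e) * ψ p - f p * ψ p) - f p * fderiv ℝ ψ p e) := by
          congr 1; ext p; ring
      _ = ∫ p, (1 / ε * (f p * ψ (p + ε • e) - f p * ψ p) - f p * fderiv ℝ ψ p e) := by
          rw [integral_sub (i5.const_mul _) i3, integral_sub (i6.const_mul _) i3,
            integral_const_mul, integral_const_mul, integral_sub i1 i2, integral_sub i4 i2, h1]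
      _ = _ := by congr 1; ext p; ring
  rw [h2]
  refine abs_integral_le_closedBall hf.locallyIntegrable (fun p => ?_) (fun p hp => ?_)
  · rw [abs_mul, mul_comm]
    gcongr
    have h3 := hC p (ε • e)
    have h4 : 1 / ε * (ψ (p + ε • e) - ψ p) - fderiv ℝ ψ p e =
        1 / ε * (ψ (p + ε • e) - ψ p - fderiv ℝ ψ p (ε • e)) := by
      rw [map_smul, smul_eq_mul]
      field_simp
    rw [h4, abs_mul, abs_of_pos (by positivity : 0 < 1 / ε)]
    calc 1 / ε * _ ≤ 1 / ε * (C * ε ^ 2) := by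
          gcongr
          exact h3.trans (by gcongr)
      _ = C * ε := by field_simp
  · by_contra hcon
    rw [not_le, max_lt_iff] at hcon
    refine hp ?_
    have a1 : ψ p = 0 := by
      by_contra h
      linarith [hR p h]
    have a2 : ψ (p + ε • e) = 0 := by
      by_contra h
      have := norm_sub_le (p + ε • e) (ε • e)
      rw [add_sub_cancel_right] at this
      linarith [hR _ h]
    have a3 : fderiv ℝ ψ p = 0 := by
      by_contra h
      have := hR' (subset_tsupport _ h)
      rw [mem_closedBall_zero_iff] at this
      linarith
    simp [a1, a2, a3]

theorem norm_upwindDir (i : Fin 4) : ‖upwindDir i‖ ≤ 1 := by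
  fin_cases i <;> simp [upwindDir, Prod.norm_def]

/-- Opposite directions combine through `x⁺ - x⁻ = x`: the first moment of the four weights is the
velocity field itself. -/
theorem sum_upwindWeight_mul (u v : ℝ × ℝ →ᵇ ℝ) (p : ℝ × ℝ) (T : ℝ × ℝ →L[ℝ] ℝ) :
    ∑ i, upwindWeight u v i p * T (upwindDir i) = u p * T (1, 0) + v p * T (0, 1) := by
  have h : ∀ x : ℝ, max 0 x - max 0 (-x) = x := fun x => by
    rcases le_total 0 x with h | h
    · rw [max_eq_right h, max_eq_left (by linarith), sub_zero]
    · rw [max_eq_left h, max_eq_right (by linarith)]; ring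
  have h1 : T (-1, 0) = -T (1, 0) := by rw [← map_neg]; simp
  have h2 : T (0, -1) = -T (0, 1) := by rw [← map_neg]; simp
  simp only [upwindWeight_apply, Fin.sum_univ_four]
  simp only [upwindDir, Matrix.cons_val, h1, h2]
  linear_combination T (1, 0) * h (u p) + T (0, 1) * h (v p)

theorem torusL1_mul_upwindWeight_le {u v X : ℝ × ℝ →ᵇ ℝ} {M : ℝ} (hu : ‖u‖ ≤ M) (hv : ‖v‖ ≤ M)
    (i : Fin 4) : torusL1 ⇑(X * upwindWeight u v i) ≤ 2 * M * torusL1 X := by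
  have hM : 0 ≤ M := (norm_nonneg _).trans hu
  have h1 := torusL1_mono (f := ⇑(X * upwindWeight u v i)) (g := fun p => 2 * M * X p)
    (X * upwindWeight u v i).continuous (by fun_prop) fun p => by
      rw [BoundedContinuousFunction.coe_mul, Pi.mul_apply, abs_mul, abs_mul, mul_comm,
        abs_of_nonneg (by positivity : 0 ≤ 2 * M),
        abs_of_nonneg (upwindWeight_nonneg u v i p)]
      gcongr
      have := upwindWeight_le u v i p
      have h2 := u.norm_coe_le_norm p
      have h3 := v.norm_coe_le_norm p
      rw [Real.norm_eq_abs] at h2 h3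
      linarith
  refine h1.trans (le_of_eq ?_)
  simp only [torusL1, abs_mul]
  rw [integral_const_mul, abs_of_nonneg (by positivity : 0 ≤ M), abs_two]

/-- Weak consistency of the upwind discretization, after application of an operator `L` which
commutes with translations and is bounded for the `L¹` norm. -/
theorem IsTestFunction.exists_upwind_bound {ψ : ℝ × ℝ → ℝ} (hψ : IsTestFunction ψ) :
    ∃ C : ℝ, 0 ≤ C ∧ ∀ (M κ ε : ℝ) (L : (ℝ × ℝ →ᵇ ℝ) →L[ℝ] (ℝ × ℝ →ᵇ ℝ)), 0 ≤ κ →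
      (∀ a f, L (shiftCLM a f) = shiftCLM a (L f)) →
      (∀ f : ℝ × ℝ →ᵇ ℝ, IsTorusPeriodic f →
        IsTorusPeriodic (L f) ∧ torusL1 (L f) ≤ κ * torusL1 f) →
      0 < ε → ε ≤ 1 → ∀ u v X : ℝ × ℝ →ᵇ ℝ, ‖u‖ ≤ M → ‖v‖ ≤ M → IsTorusPeriodic u →
      IsTorusPeriodic v → IsTorusPeriodic X →
      |∫ p, (L (upwindCLM ε u v X) p * ψ p - L (X * u) p * partialX ψ p -
        L (X * v) p * partialY ψ p)| ≤ C * M * κ * torusL1 X * ε := by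
  obtain ⟨C, R, hC0, hC⟩ := hψ.exists_difference_bound
  obtain ⟨n, hn, hball⟩ := exists_setIntegral_closedBall_le R
  -- Four directions, each with the factor `2 * M` that bounds its weight.
  refine ⟨8 * C * n, by positivity, fun M κ ε L hκ hLs hL hε hε1 u v X hu hv hpu hpv hpX => ?_⟩
  have hψc := hψ.1.continuous
  set G : Fin 4 → (ℝ × ℝ →ᵇ ℝ) := fun i => L (X * upwindWeight u v i)
  have hGp : ∀ i, IsTorusPeriodic (G i) ∧ torusL1 (G i) ≤ κ * (2 * M * torusL1 X) := fun i => by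
    have h1 := hL (X * upwindWeight u v i) (hpX.mul (isTorusPeriodic_upwindWeight hpu hpv i))
    exact ⟨h1.1, h1.2.trans (mul_le_mul_of_nonneg_left (torusL1_mul_upwindWeight_le hu hv i) hκ)⟩
  have e1 : ∀ p, L (upwindCLM ε u v X) p =
      ∑ i, 1 / ε * (G i (p - ε • upwindDir i) - G i p) := fun p => by
    have : upwindCLM ε u v X = (1 / ε) • ∑ i,
        (shiftCLM (-(ε • upwindDir i)) (X * upwindWeight u v i) - X * upwindWeight u v i) := by
      simp [upwindCLM, mul_comm]
    rw [this, map_smul, map_sum]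
    simp only [map_sub, hLs]
    simp [G, BoundedContinuousFunction.coe_sum, sub_eq_add_neg, Finset.mul_sum]
  have e2 : ∀ p, L (X * u) p * partialX ψ p + L (X * v) p * partialY ψ p =
      ∑ i, G i p * fderiv ℝ ψ p (upwindDir i) := fun p => by
    -- The point `p` is fixed, so the partial derivatives of `ψ` enter as constants `a` and `b`,
    -- which pass through the linear operator `L`; the identity is proved before `L` is applied.
    have hw : ∀ a b : ℝ, a • (X * u) + b • (X * v) =
        ∑ i, (ContinuousLinearMap.coprod (a • ContinuousLinearMap.id ℝ ℝ)
          (b • ContinuousLinearMap.id ℝ ℝ)) (upwindDir i) • (X * upwindWeight u v i) := by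
      intro a b
      ext q
      have := sum_upwindWeight_mul u v q (ContinuousLinearMap.coprod
        (a • ContinuousLinearMap.id ℝ ℝ) (b • ContinuousLinearMap.id ℝ ℝ))
      simp only [BoundedContinuousFunction.coe_sum, Finset.sum_apply,
        BoundedContinuousFunction.coe_add, Pi.add_apply, BoundedContinuousFunction.coe_smul,
        BoundedContinuousFunction.coe_mul, Pi.mul_apply, smul_eq_mul]
      have h3 : ∀ i : Fin 4, (ContinuousLinearMap.coprod (a • ContinuousLinearMap.id ℝ ℝ)
          (b • ContinuousLinearMap.id ℝ ℝ)) (upwindDir i) * (X q * upwindWeight u v i q) =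
          X q * (upwindWeight u v i q * (ContinuousLinearMap.coprod
            (a • ContinuousLinearMap.id ℝ ℝ) (b • ContinuousLinearMap.id ℝ ℝ)) (upwindDir i)) :=
        fun i => by ring
      simp only [h3, ← Finset.mul_sum, this]
      simp
      ring
    have hT : fderiv ℝ ψ p = ContinuousLinearMap.coprod
        (partialX ψ p • ContinuousLinearMap.id ℝ ℝ) (partialY ψ p • ContinuousLinearMap.id ℝ ℝ) := by
      rw [hψ.partialX_eq, hψ.partialY_eq]
      ext <;> simp
    have h4 := DFunLike.congr_fun (congrArg L (hw (partialX ψ p) (partialY ψ p))) p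
    rw [hT]
    simp only [map_add, map_smul, map_sum, BoundedContinuousFunction.coe_sum, Finset.sum_apply,
      BoundedContinuousFunction.coe_add, Pi.add_apply, BoundedContinuousFunction.coe_smul,
      smul_eq_mul] at h4
    simp only [G]
    rw [mul_comm, mul_comm (L (X * v) p), h4]
    exact Finset.sum_congr rfl fun i _ => mul_comm _ _
  have e3 : ∀ p, L (upwindCLM ε u v X) p * ψ p - L (X * u) p * partialX ψ p -
      L (X * v) p * partialY ψ p = ∑ i, (1 / ε * (G i (p - ε • upwindDir i) - G i p) * ψ p -
        G i p * fderiv ℝ ψ p (upwindDir i)) := fun p => by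
    rw [sub_sub, e2, e1, Finset.sum_sub_distrib, Finset.sum_mul]
  simp_rw [e3]
  rw [integral_finsetSum]
  · refine (Finset.abs_sum_le_sum_abs _ _).trans ?_
    have h5 : ∀ i ∈ Finset.univ, |∫ p, (1 / ε * (G i (p - ε • upwindDir i) - G i p) * ψ p -
        G i p * fderiv ℝ ψ p (upwindDir i))| ≤ C * ε * (n * (κ * (2 * M * torusL1 X))) :=
      fun i _ => by
        refine (hC ε hε hε1 _ (norm_upwindDir i) (G i) (G i).continuous).trans ?_
        gcongr
        refine (hball (G i) (hGp i).1 (G i).continuous 0).trans ?_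
        gcongr
        exact (hGp i).2
    refine (Finset.sum_le_sum h5).trans (le_of_eq ?_)
    simp
    ring
  · intro i _
    have hc := hψ.continuous_fderiv_apply (upwindDir i)
    have hG := (G i).continuous
    refine Integrable.sub ?_ ?_
    · exact Continuous.integrable_of_hasCompactSupport (by fun_prop) hψ.2.mul_left
    · exact Continuous.integrable_of_hasCompactSupport (by fun_prop)
        (hψ.hasCompactSupport_fderiv_apply _).mul_left

/-- The commutator of the mollification with the multiplication by a Lipschitz function is small
in `L¹` on bounded sets. -/
theorem exists_commutator_bound {k : ℝ × ℝ → ℝ} (hk : Continuous k) (hk' : HasCompactSupport k)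
    (R : ℝ) : ∃ C : ℝ, 0 ≤ C ∧ ∀ (h Λ : ℝ), 0 < h → 0 ≤ Λ → ∀ f g : ℝ × ℝ → ℝ,
      IsTorusPeriodic f → Continuous f → Continuous g → (∀ p q, |g q - g p| ≤ Λ * ‖p - q‖) →
      ∫ p in Metric.closedBall 0 R, |planeConv (fun q => f q * g q) (scaledKernel k h) p -
        g p * planeConv f (scaledKernel k h) p| ≤ C * Λ * torusL1 f * h := by
  obtain ⟨r, hr0, hr⟩ := hk'.exists_radius
  obtain ⟨n, hn, hball⟩ := exists_setIntegral_closedBall_le R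
  refine ⟨r * n * ∫ q, |k q|,
    mul_nonneg (mul_nonneg hr0 hn) (integral_nonneg fun _ => abs_nonneg _),
    fun h Λ hh hΛ f g hp hf hg hL => ?_⟩
  have kc := continuous_scaledKernel hk h
  have ks := hasCompactSupport_scaledKernel hk' hh
  have ks' : HasCompactSupport fun q => |scaledKernel k h q| := ks.comp_left (g := abs) abs_zero
  have hc1 := continuous_planeConv (f := fun q => f q * g q) (hf.mul hg) kc ks
  have hc2 := continuous_planeConv hf kc ks
  have hc3 := continuous_planeConv hf.abs kc.abs ks'
  have hi : ∀ {F : ℝ × ℝ → ℝ}, Continuous F → IntegrableOn F (Metric.closedBall 0 R) := fun hF =>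
    hF.continuousOn.integrableOn_compact (isCompact_closedBall _ _)
  calc _ ≤ ∫ p in Metric.closedBall 0 R,
        Λ * (r * h) * |planeConv (fun q => |f q|) (fun q => |scaledKernel k h q|) p| := by
        refine setIntegral_mono (hi (by fun_prop)) (hi (by fun_prop)) fun p => ?_
        refine (abs_planeConv_mul_sub_le hf hg kc ks hΛ hL (scaledKernel_norm_le hh hr) p).trans ?_
        gcongr
        exact le_abs_self _
    _ ≤ Λ * (r * h) * (n * (torusL1 f * ∫ q, |k q|)) := by
        rw [integral_const_mul]
        gcongr
        refine (hball _ ((hp.comp abs).planeConv _) hc3 0).trans ?_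
        gcongr
        refine (torusL1_planeConv_le (hp.comp abs) hf.abs kc.abs ks').trans (le_of_eq ?_)
        simp only [abs_abs, torusL1, integral_abs_scaledKernel k hh]
    _ = _ := by ring

/-- A bound for both partial derivatives gives a Lipschitz bound. -/
theorem abs_sub_le_of_partial_bound {f : ℝ × ℝ → ℝ} {c : ℝ}
    (hd : ∀ p : ℝ × ℝ, DifferentiableAt ℝ (fun s : ℝ => f (s, p.2)) p.1 ∧
      DifferentiableAt ℝ (fun s : ℝ => f (p.1, s)) p.2)
    (hb : ∀ p, |partialX f p| ≤ c ∧ |partialY f p| ≤ c) (p q : ℝ × ℝ) :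
    |f q - f p| ≤ 2 * c * ‖p - q‖ := by
  have hc : 0 ≤ c := (abs_nonneg _).trans (hb 0).1
  have h1 : |f (q.1, q.2) - f (p.1, q.2)| ≤ c * ‖q.1 - p.1‖ :=
    convex_univ.norm_image_sub_le_of_norm_deriv_le (f := fun s => f (s, q.2))
      (fun s _ => (hd (s, q.2)).1) (fun s _ => (hb (s, q.2)).1) (mem_univ _) (mem_univ _)
  have h2 : |f (p.1, q.2) - f (p.1, p.2)| ≤ c * ‖q.2 - p.2‖ :=
    convex_univ.norm_image_sub_le_of_norm_deriv_le (f := fun s => f (p.1, s))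
      (fun s _ => (hd (p.1, s)).2) (fun s _ => (hb (p.1, s)).2) (mem_univ _) (mem_univ _)
  have h3 : ‖q.1 - p.1‖ ≤ ‖p - q‖ := by
    rw [norm_sub_rev p q]; exact norm_fst_le (q - p)
  have h4 : ‖q.2 - p.2‖ ≤ ‖p - q‖ := by
    rw [norm_sub_rev p q]; exact norm_snd_le (q - p)
  have h5 := abs_sub_le (f (q.1, q.2)) (f (p.1, q.2)) (f (p.1, p.2))
  have h6 := mul_le_mul_of_nonneg_left h3 hc
  have h7 := mul_le_mul_of_nonneg_left h4 hc
  change |f (q.1, q.2) - f (p.1, p.2)| ≤ _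
  linarith

end Consistency

/-! ### The pressure source: size and integration by parts. -/

section Pressure

theorem exists_abs_eval_le (P : Polynomial ℝ) : ∃ c : ℝ, 0 ≤ c ∧ ∀ R : ℝ, 1 ≤ R → ∀ r : ℝ,
    |r| ≤ R → |P.eval r| ≤ c * R ^ P.natDegree := by
  refine ⟨∑ i ∈ Finset.range (P.natDegree + 1), |P.coeff i|,
    Finset.sum_nonneg fun _ _ => abs_nonneg _, fun R hR r hr => ?_⟩
  rw [Polynomial.eval_eq_sum_range, Finset.sum_mul]
  refine (Finset.abs_sum_le_sum_abs _ _).trans (Finset.sum_le_sum fun i hi => ?_)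
  rw [abs_mul, abs_pow]
  gcongr
  calc |r| ^ i ≤ R ^ i := by gcongr
    _ ≤ R ^ P.natDegree :=
      pow_le_pow_right₀ hR (Nat.lt_succ_iff.1 (Finset.mem_range.1 hi))

theorem aeval_boundedContinuousFunction_apply (P : Polynomial ℝ) (r : ℝ × ℝ →ᵇ ℝ) (p : ℝ × ℝ) :
    Polynomial.aeval r P p = P.eval (r p) := by
  induction P using Polynomial.induction_on' with
  | add P Q hP hQ => simp [hP, hQ]
  | monomial n a => simp [Polynomial.aeval_monomial]

/-- `-P'(r) rx - Q'(r) ry` as a bounded continuous function. -/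
noncomputable def pressureBCF (P Q : Polynomial ℝ) (r rx ry : ℝ × ℝ →ᵇ ℝ) : ℝ × ℝ →ᵇ ℝ :=
  -(Polynomial.aeval r P.derivative * rx) - Polynomial.aeval r Q.derivative * ry

theorem pressureBCF_apply (P Q : Polynomial ℝ) (r rx ry : ℝ × ℝ →ᵇ ℝ) (p : ℝ × ℝ) :
    pressureBCF P Q r rx ry p =
      -(P.derivative.eval (r p) * rx p) - Q.derivative.eval (r p) * ry p := by
  simp [pressureBCF, aeval_boundedContinuousFunction_apply]

theorem continuousOn_pressureBCF (P Q : Polynomial ℝ) {r rx ry : ℝ → (ℝ × ℝ →ᵇ ℝ)} {s : Set ℝ}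
    (hr : ContinuousOn r s) (hx : ContinuousOn rx s) (hy : ContinuousOn ry s) :
    ContinuousOn (fun t => pressureBCF P Q (r t) (rx t) (ry t)) s :=
  (((P.derivative.continuous_aeval.comp_continuousOn hr).mul hx).neg).sub
    ((Q.derivative.continuous_aeval.comp_continuousOn hr).mul hy)

theorem isTorusPeriodic_pressureBCF (P Q : Polynomial ℝ) {r rx ry : ℝ × ℝ →ᵇ ℝ}
    (hr : IsTorusPeriodic r) (hx : IsTorusPeriodic rx) (hy : IsTorusPeriodic ry) :
    IsTorusPeriodic (pressureBCF P Q r rx ry) := fun x y => by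
  simp only [pressureBCF_apply, (hr x y).1, (hr x y).2, (hx x y).1, (hx x y).2, (hy x y).1,
    (hy x y).2, and_self]

/-- Since `R ≥ 1`, the sum of the two degrees is an exponent that dominates both terms. -/
theorem exists_pressure_bound (P Q : Polynomial ℝ) : ∃ c : ℝ, 0 ≤ c ∧ ∀ R R' : ℝ, 1 ≤ R →
    ∀ r rx ry : ℝ × ℝ →ᵇ ℝ, (∀ p, |r p| ≤ R ∧ |rx p| ≤ R' ∧ |ry p| ≤ R') →
      ‖pressureBCF P Q r rx ry‖ ≤
        c * R ^ (P.derivative.natDegree + Q.derivative.natDegree) * R' := by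
  obtain ⟨c, hc, hP⟩ := exists_abs_eval_le P.derivative
  obtain ⟨d, hd, hQ⟩ := exists_abs_eval_le Q.derivative
  refine ⟨c + d, by positivity, fun R R' hR r rx ry h => ?_⟩
  have hR' : 0 ≤ R' := (abs_nonneg _).trans (h 0).2.1
  have hR0 : 0 ≤ R := zero_le_one.trans hR
  set m := P.derivative.natDegree
  set n := Q.derivative.natDegree
  refine (BoundedContinuousFunction.norm_le (by positivity)).2 fun p => ?_
  obtain ⟨h1, h2, h3⟩ := h p
  rw [pressureBCF_apply, Real.norm_eq_abs]
  refine (abs_sub _ _).trans ?_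
  rw [abs_neg, abs_mul, abs_mul]
  have hm : R ^ m ≤ R ^ (m + n) := pow_le_pow_right₀ hR (Nat.le_add_right _ _)
  have hn : R ^ n ≤ R ^ (m + n) := pow_le_pow_right₀ hR (Nat.le_add_left _ _)
  calc _ ≤ c * R ^ (m + n) * R' + d * R ^ (m + n) * R' := by
        gcongr
        · exact (hP R hR _ h1).trans (by gcongr)
        · exact (hQ R hR _ h1).trans (by gcongr)
    _ = _ := by ring

/-- Chain rule and integration by parts, without boundary terms because `ψ` has compact support. It
makes the pressure part of the equation for `w` hold without error. -/
theorem integral_eval_derivative_mul (P : Polynomial ℝ) {r ψ : ℝ × ℝ → ℝ} (hr : ContDiff ℝ ∞ r)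
    (hψ : IsTestFunction ψ) (e : ℝ × ℝ) :
    ∫ p, P.eval (r p) * fderiv ℝ ψ p e =
      -∫ p, P.derivative.eval (r p) * fderiv ℝ r p e * ψ p := by
  have hrd : Differentiable ℝ r := hr.differentiable (by simp)
  have hrc : Continuous fun p => fderiv ℝ r p e :=
    (hr.continuous_fderiv (by simp)).clm_apply continuous_const
  have hc := hr.continuous
  have hψc := hψ.1.continuous
  have hψe := hψ.continuous_fderiv_apply e
  have hd : ∀ p, HasFDerivAt (fun p => P.eval (r p)) (P.derivative.eval (r p) • fderiv ℝ r p) p :=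
    fun p => (P.hasDerivAt (r p)).comp_hasFDerivAt p (hrd p).hasFDerivAt
  have hfd : ∀ p, fderiv ℝ (fun p => P.eval (r p)) p e = P.derivative.eval (r p) * fderiv ℝ r p e :=
    fun p => by rw [(hd p).fderiv]; rfl
  have hP : Continuous fun p => P.eval (r p) := P.continuous.comp hc
  have hP' : Continuous fun p => P.derivative.eval (r p) := P.derivative.continuous.comp hc
  have h := integral_mul_fderiv_eq_neg_fderiv_mul_of_integrable (μ := volume)
    (f := fun p => P.eval (r p)) (g := ψ) (v := e) (by
      simp_rw [hfd]
      exact Continuous.integrable_of_hasCompactSupport (by fun_prop) hψ.2.mul_left)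
    (Continuous.integrable_of_hasCompactSupport (by fun_prop)
      (hψ.hasCompactSupport_fderiv_apply e).mul_left)
    (Continuous.integrable_of_hasCompactSupport (by fun_prop) hψ.2.mul_left)
    (fun p _ => (hd p).differentiableAt) (fun p _ => hψ.differentiable p)
  simp_rw [hfd] at h
  exact h

end Pressure

/-! ### Weak form of the continuity equation, and mollified initial data. -/

section WeakForms

/-- Derivatives fall on the kernel, where each costs a factor `1 / h`; the sup bound is then applied
to `φ` and to its partial derivatives. -/
theorem exists_mollification_bounds {φ : ℝ × ℝ → ℝ} (hφ : IsTestFunction φ) :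
    ∃ C : ℝ, 0 ≤ C ∧ ∀ h : ℝ, 0 < h → h ≤ 1 → ∀ f : ℝ × ℝ → ℝ, IsTorusPeriodic f →
      Continuous f → ∀ p, |planeConv f (scaledKernel φ h) p| ≤ C * torusL1 f / h ^ 2 ∧
        |partialX (planeConv f (scaledKernel φ h)) p| ≤ C * torusL1 f / h ^ 3 ∧
        |partialY (planeConv f (scaledKernel φ h)) p| ≤ C * torusL1 f / h ^ 3 := by
  obtain ⟨C₁, h₁, H₁⟩ := exists_abs_planeConv_scaledKernel_le hφ.1.continuous hφ.2
  obtain ⟨C₂, h₂, H₂⟩ := exists_abs_planeConv_scaledKernel_le hφ.continuous_partialX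
    hφ.hasCompactSupport_partialX
  obtain ⟨C₃, h₃, H₃⟩ := exists_abs_planeConv_scaledKernel_le hφ.continuous_partialY
    hφ.hasCompactSupport_partialY
  refine ⟨C₁ + C₂ + C₃, by positivity, fun h hh hh1 f hp hf p => ?_⟩
  have hmul : ∀ k : ℝ × ℝ → ℝ, planeConv f (fun q => 1 / h * k q) p = 1 / h * planeConv f k p :=
    fun k => by
      simp only [planeConv_apply, ← integral_const_mul]
      congr 1
      ext q
      ring
  have ht := torusL1_nonneg f
  have hs := isTestFunction_scaledKernel hφ hh
  have key : ∀ a b : ℝ, 0 ≤ a → a ≤ C₁ + C₂ + C₃ → |b| ≤ a * torusL1 f / h ^ 2 →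
      |1 / h * b| ≤ (C₁ + C₂ + C₃) * torusL1 f / h ^ 3 := fun a b _ ha hb => by
    rw [abs_mul, abs_of_pos (by positivity : 0 < 1 / h)]
    calc 1 / h * |b| ≤ 1 / h * ((C₁ + C₂ + C₃) * torusL1 f / h ^ 2) := by
          gcongr
          exact hb.trans (by gcongr)
      _ = _ := by field_simp
  refine ⟨(H₁ h hh hh1 f hp hf p).trans (by gcongr; linarith), ?_, ?_⟩
  · rw [partialX_planeConv hf hs, partialX_scaledKernel hφ, hmul]
    exact key C₂ _ h₂ (by linarith) (H₂ h hh hh1 f hp hf p)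
  · rw [partialY_planeConv hf hs, partialY_scaledKernel hφ, hmul]
    exact key C₃ _ h₃ (by linarith) (H₃ h hh hh1 f hp hf p)

/-- Two errors add up. Convolution commutes with translations and is bounded on `L¹` by `∫ |φ|`, so
the upwind consistency applies after it and gives `M * ε`; replacing `(X u) * φ_h` by `u (X * φ_h)`,
and likewise for `v`, gives `Λ * h`. -/
theorem IsTestFunction.exists_continuity_bound {φ ψ : ℝ × ℝ → ℝ} (hψ : IsTestFunction ψ)
    (hφ : Continuous φ) (hφ' : HasCompactSupport φ) :
    ∃ C : ℝ, 0 ≤ C ∧ ∀ (M Λ ε h : ℝ) (hh : 0 < h), 0 < ε → ε ≤ 1 → 0 ≤ Λ →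
      ∀ u v X : ℝ × ℝ →ᵇ ℝ, ‖u‖ ≤ M → ‖v‖ ≤ M → IsTorusPeriodic u → IsTorusPeriodic v →
      IsTorusPeriodic X → (∀ p q, |u q - u p| ≤ Λ * ‖p - q‖) →
      (∀ p q, |v q - v p| ≤ Λ * ‖p - q‖) →
      |∫ p, (convCLM (scaledKernel φ h) (continuous_scaledKernel hφ h)
            (hasCompactSupport_scaledKernel hφ' hh) (upwindCLM ε u v X) p * ψ p -
          u p * planeConv X (scaledKernel φ h) p * partialX ψ p -
          v p * planeConv X (scaledKernel φ h) p * partialY ψ p)| ≤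
        C * torusL1 X * (M * ε + Λ * h) := by
  obtain ⟨C, hC0, hC⟩ := hψ.exists_upwind_bound
  obtain ⟨R, hR0, hR⟩ := hψ.hasCompactSupport_partialX.exists_radius
  obtain ⟨R', hR'0, hR'⟩ := hψ.hasCompactSupport_partialY.exists_radius
  obtain ⟨a, ha⟩ := hψ.continuous_partialX.bounded_above_of_compact_support
    hψ.hasCompactSupport_partialX
  obtain ⟨a', ha'⟩ := hψ.continuous_partialY.bounded_above_of_compact_support
    hψ.hasCompactSupport_partialY
  have ha0 : 0 ≤ a := (norm_nonneg _).trans (ha 0)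
  have ha0' : 0 ≤ a' := (norm_nonneg _).trans (ha' 0)
  obtain ⟨B, hB0, hB⟩ := exists_commutator_bound hφ hφ' R
  obtain ⟨B', hB'0, hB'⟩ := exists_commutator_bound hφ hφ' R'
  set κ := ∫ q, |φ q|
  have hκ : 0 ≤ κ := integral_nonneg fun _ => abs_nonneg _
  refine ⟨C * κ + a * B + a' * B', by positivity, ?_⟩
  intro M Λ ε h hh hε hε1 hΛ u v X hu hv hpu hpv hpX hLu hLv
  have kc := continuous_scaledKernel hφ h
  have ks := hasCompactSupport_scaledKernel hφ' hh
  set L := convCLM (scaledKernel φ h) kc ks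
  have hM : 0 ≤ M := (norm_nonneg _).trans hu
  have ht := torusL1_nonneg X
  have hLX : ∀ p, planeConv X (scaledKernel φ h) p = L X p := fun p => rfl
  have e1 := hC M κ ε L hκ (fun a f => by
      ext p
      exact (planeConv_add_const f (scaledKernel φ h) a p).symm)
    (fun f hf => ⟨hf.planeConv _, by
      have := torusL1_planeConv_le hf f.continuous kc ks
      rw [integral_abs_scaledKernel φ hh, mul_comm] at this
      exact this⟩) hε hε1 u v X hu hv hpu hpv hpX
  have e2 : |∫ p, (L (X * u) p - u p * L X p) * partialX ψ p| ≤ a * (B * Λ * torusL1 X * h) := by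
    refine (abs_integral_le_closedBall (g := fun p => L (X * u) p - u p * L X p) (c := a) (R := R)
      (Continuous.locallyIntegrable (by fun_prop)) (fun p => ?_) fun p hp => ?_).trans ?_
    · rw [abs_mul, mul_comm]
      gcongr
      exact ha p
    · exact hR p (right_ne_zero_of_mul hp)
    · exact mul_le_mul_of_nonneg_left
        (hB h Λ hh hΛ X u hpX X.continuous u.continuous hLu) ha0
  have e3 : |∫ p, (L (X * v) p - v p * L X p) * partialY ψ p| ≤
      a' * (B' * Λ * torusL1 X * h) := by
    refine (abs_integral_le_closedBall (g := fun p => L (X * v) p - v p * L X p) (c := a') (R := R')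
      (Continuous.locallyIntegrable (by fun_prop)) (fun p => ?_) fun p hp => ?_).trans ?_
    · rw [abs_mul, mul_comm]
      gcongr
      exact ha' p
    · exact hR' p (right_ne_zero_of_mul hp)
    · exact mul_le_mul_of_nonneg_left
        (hB' h Λ hh hΛ X v hpX X.continuous v.continuous hLv) ha0'
  have hψc := hψ.1.continuous
  have hψx := hψ.continuous_partialX
  have hψy := hψ.continuous_partialY
  have iψ : ∀ {F : ℝ × ℝ → ℝ}, Continuous F → Integrable fun p => F p * ψ p := fun hF =>
    (hF.mul hψc).integrable_of_hasCompactSupport hψ.2.mul_left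
  have ix : ∀ {F : ℝ × ℝ → ℝ}, Continuous F → Integrable fun p => F p * partialX ψ p := fun hF =>
    (hF.mul hψx).integrable_of_hasCompactSupport hψ.hasCompactSupport_partialX.mul_left
  have iy : ∀ {F : ℝ × ℝ → ℝ}, Continuous F → Integrable fun p => F p * partialY ψ p := fun hF =>
    (hF.mul hψy).integrable_of_hasCompactSupport hψ.hasCompactSupport_partialY.mul_left
  have i1 : Integrable fun p => L (upwindCLM ε u v X) p * ψ p - L (X * u) p * partialX ψ p -
      L (X * v) p * partialY ψ p :=
    ((iψ (by fun_prop)).sub (ix (by fun_prop))).sub (iy (by fun_prop))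
  have i2 : Integrable fun p => (L (X * u) p - u p * L X p) * partialX ψ p := ix (by fun_prop)
  have i3 : Integrable fun p => (L (X * v) p - v p * L X p) * partialY ψ p := iy (by fun_prop)
  have i4 : Integrable fun p => (L (X * u) p - u p * L X p) * partialX ψ p +
      (L (X * v) p - v p * L X p) * partialY ψ p := i2.add i3
  have e4 : ∫ p, (L (upwindCLM ε u v X) p * ψ p -
      u p * planeConv X (scaledKernel φ h) p * partialX ψ p -
      v p * planeConv X (scaledKernel φ h) p * partialY ψ p) =
      (∫ p, (L (upwindCLM ε u v X) p * ψ p - L (X * u) p * partialX ψ p -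
        L (X * v) p * partialY ψ p)) + ((∫ p, (L (X * u) p - u p * L X p) * partialX ψ p) +
        ∫ p, (L (X * v) p - v p * L X p) * partialY ψ p) := by
    rw [← integral_add i2 i3, ← integral_add i1 i4]
    congr 1
    ext p
    rw [hLX]
    ring
  rw [e4]
  refine (abs_add_le _ _).trans ((add_le_add e1 ((abs_add_le _ _).trans (add_le_add e2 e3))).trans ?_)
  -- These cross terms are absent from the estimate; adding them puts the bound in product form.
  have n1 : 0 ≤ C * κ * torusL1 X * (Λ * h) := by positivity
  have n2 : 0 ≤ (a * B + a' * B') * torusL1 X * (M * ε) := by positivity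
  nlinarith

/-- Mollification is consistent in the sense of distributions. -/
theorem IsTestFunction.exists_mollification_consistency {φ ψ : ℝ × ℝ → ℝ} (hψ : IsTestFunction ψ)
    (hφ : Continuous φ) (hφ' : HasCompactSupport φ) (h1 : ∫ p, φ p = 1) :
    ∃ C : ℝ, 0 ≤ C ∧ ∀ h : ℝ, 0 < h → h ≤ 1 → ∀ f : ℝ × ℝ → ℝ, IsTorusPeriodic f →
      Continuous f → |(∫ p, planeConv f (scaledKernel φ h) p * ψ p) - ∫ p, f p * ψ p| ≤
        C * torusL1 f * h := by
  obtain ⟨Λ, hΛ⟩ := ContDiff.lipschitzWith_of_hasCompactSupport hψ.2 hψ.contDiff_one one_ne_zero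
  obtain ⟨R, hR0, hR⟩ := hψ.2.exists_radius
  obtain ⟨r, hr0, hr⟩ := hφ'.exists_radius
  -- For `h ≤ 1` the function `(f ψ) * φ_h` is supported in the ball of radius `R + r`.
  obtain ⟨B, hB0, hB⟩ := exists_commutator_bound hφ hφ' (R + r)
  refine ⟨B * Λ, by positivity, fun h hh hh1 f hp hf => ?_⟩
  have kc := continuous_scaledKernel hφ h
  have ks := hasCompactSupport_scaledKernel hφ' hh
  have hψc := hψ.1.continuous
  have hc1 := continuous_planeConv (f := fun q => f q * ψ q) (hf.mul hψc) kc ks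
  have hc2 := continuous_planeConv hf kc ks
  have ifψ : Integrable fun p => f p * ψ p :=
    (hf.mul hψc).integrable_of_hasCompactSupport hψ.2.mul_left
  have ik : Integrable (scaledKernel φ h) := kc.integrable_of_hasCompactSupport ks
  -- The kernel has mass one, so mollifying `f ψ` preserves its integral; the error becomes a
  -- commutator with the Lipschitz function `ψ`.
  have e1 : ∫ p, planeConv (fun q => f q * ψ q) (scaledKernel φ h) p = ∫ p, f p * ψ p := by
    have := integral_convolution (ContinuousLinearMap.mul ℝ ℝ) ifψ ik
    rw [integral_scaledKernel φ hh, h1] at this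
    simpa using this
  have ic : Integrable (planeConv (fun q => f q * ψ q) (scaledKernel φ h)) :=
    ifψ.integrable_convolution _ ik
  have i2 : Integrable fun p => planeConv f (scaledKernel φ h) p * ψ p :=
    (hc2.mul hψc).integrable_of_hasCompactSupport hψ.2.mul_left
  rw [← e1, abs_sub_comm, ← integral_sub ic i2]
  refine (abs_integral_le_closedBall (c := 1) (R := R + r)
    (g := fun p => planeConv (fun q => f q * ψ q) (scaledKernel φ h) p -
      ψ p * planeConv f (scaledKernel φ h) p) (Continuous.locallyIntegrable (by fun_prop))
    (fun p => by rw [one_mul, mul_comm (ψ p)]) fun p hp0 => ?_).trans ?_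
  · by_contra hcon
    rw [not_le] at hcon
    refine hp0 ?_
    have a1 : ψ p = 0 := by
      by_contra h0
      linarith [hR p h0]
    have a2 : planeConv (fun q => f q * ψ q) (scaledKernel φ h) p = 0 := by
      rw [planeConv_apply]
      refine integral_eq_zero_of_ae (ae_of_all _ fun q => ?_)
      by_contra h0
      have b1 := hR q (right_ne_zero_of_mul (left_ne_zero_of_mul h0))
      have b2 := scaledKernel_norm_le hh hr _ (right_ne_zero_of_mul h0)
      have b3 := norm_add_le q (p - q)
      rw [add_sub_cancel] at b3
      have b4 : r * h ≤ r := mul_le_of_le_one_right hr0 hh1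
      linarith
    rw [a1, a2, mul_zero, sub_zero]
  · rw [one_mul]
    refine (hB h Λ hh Λ.2 f ψ hp hf hψc fun p q => ?_)
    have := hΛ.dist_le_mul q p
    rwa [Real.dist_eq, dist_eq_norm, norm_sub_rev] at this

theorem IsTestFunction.exists_integral_sub_bound {ψ : ℝ × ℝ → ℝ} (hψ : IsTestFunction ψ) :
    ∃ C : ℝ, 0 ≤ C ∧ ∀ f g : ℝ × ℝ → ℝ, IsTorusPeriodic f → IsTorusPeriodic g →
      LocallyIntegrable f → LocallyIntegrable g →
      |(∫ p, f p * ψ p) - ∫ p, g p * ψ p| ≤ C * torusL1 fun p => f p - g p := by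
  obtain ⟨R, hR0, hR⟩ := hψ.2.exists_radius
  obtain ⟨a, ha⟩ := hψ.1.continuous.bounded_above_of_compact_support hψ.2
  have ha0 : 0 ≤ a := (norm_nonneg _).trans (ha 0)
  obtain ⟨n, hn, hball⟩ := exists_setIntegral_closedBall_zero_le R
  refine ⟨a * n, by positivity, fun f g hpf hpg hf hg => ?_⟩
  have i : ∀ {f : ℝ × ℝ → ℝ}, LocallyIntegrable f → Integrable fun p => f p * ψ p := fun hf =>
    hf.integrable_smul_right_of_hasCompactSupport hψ.1.continuous hψ.2
  have hfg : LocallyIntegrable fun p => f p - g p := hf.sub hg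
  rw [← integral_sub (i hf) (i hg), mul_assoc]
  refine (abs_integral_le_closedBall (c := a) (R := R) hfg (fun p => ?_) fun p hp => ?_).trans
    (mul_le_mul_of_nonneg_left (hball _ (hpf.sub hpg) hfg) ha0)
  · rw [← sub_mul, abs_mul, mul_comm]
    gcongr
    exact ha p
  · rw [← sub_mul] at hp
    exact hR p (right_ne_zero_of_mul hp)

/-- The majorant `g` depends on `ε` only, which gives uniformity in `t`; `D` is the pointwise
one-sided time derivative. -/
theorem isWeakAsymptoticMethod_of_bound {q F G D : ℝ → ℝ → ℝ × ℝ → ℝ}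
    (hq : ∀ ε ∈ Ioo (0 : ℝ) 1, ∀ t : ℝ, 0 ≤ t → ∀ p : ℝ × ℝ,
      HasDerivWithinAt (fun s : ℝ => q ε s p) (D ε t p) (Ici 0) t)
    (hc : ∀ ε ∈ Ioo (0 : ℝ) 1, ∀ t : ℝ, 0 ≤ t →
      Continuous (D ε t) ∧ Continuous (F ε t) ∧ Continuous (G ε t))
    (hb : ∀ ψ : ℝ × ℝ → ℝ, IsTestFunction ψ → ∀ δ : ℝ, 0 < δ → ∃ g : ℝ → ℝ,
      Tendsto g (𝓝[>] 0) (𝓝 0) ∧ ∀ ε ∈ Ioo (0 : ℝ) 1, ∀ t ∈ Icc 0 δ,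
        |∫ p, (D ε t p * ψ p - F ε t p * partialX ψ p - G ε t p * partialY ψ p)| ≤ g ε) :
    IsWeakAsymptoticMethod q F G := by
  have hw : ∀ ψ, ∀ ε ∈ Ioo (0 : ℝ) 1, ∀ t : ℝ, 0 ≤ t →
      weakIntegrand (q ε) (F ε) (G ε) ψ t =
        fun p => D ε t p * ψ p - F ε t p * partialX ψ p - G ε t p * partialY ψ p := by
    intro ψ ε hε t ht
    funext p
    rw [weakIntegrand, (hq ε hε t ht p).derivWithin (uniqueDiffOn_Ici 0 t ht)]
  refine ⟨fun ε hε t ht p => (hq ε hε t ht p).differentiableWithinAt, fun ψ hψ =>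
    ⟨fun ε hε t ht => ?_, fun δ hδ => ?_⟩⟩
  · rw [hw ψ ε hε t ht]
    obtain ⟨h1, h2, h3⟩ := hc ε hε t ht
    exact (((h1.mul hψ.1.continuous).integrable_of_hasCompactSupport hψ.2.mul_left).sub
      ((h2.mul hψ.continuous_partialX).integrable_of_hasCompactSupport
        hψ.hasCompactSupport_partialX.mul_left)).sub
      ((h3.mul hψ.continuous_partialY).integrable_of_hasCompactSupport
        hψ.hasCompactSupport_partialY.mul_left)
  · obtain ⟨g, hg, hgb⟩ := hb ψ hψ δ hδ
    rw [Metric.tendstoUniformlyOn_iff]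
    intro η hη
    filter_upwards [hg.eventually_lt_const hη, Ioo_mem_nhdsGT (zero_lt_one (α := ℝ))]
      with ε h1 hε t ht
    rw [hw ψ ε hε t ht.1, Real.dist_eq, zero_sub, abs_neg]
    exact (hgb ε hε t ht).trans_lt h1

theorem tendsto_rpow_nhdsGT_zero {s : ℝ} (hs : 0 < s) :
    Tendsto (fun ε : ℝ => ε ^ s) (𝓝[>] 0) (𝓝 0) := by
  have h := (Real.continuousAt_rpow_const 0 s (Or.inr hs.le)).tendsto
  rw [Real.zero_rpow hs.ne'] at h
  exact h.mono_left nhdsWithin_le_nhds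

end WeakForms

/-! ### The two equations at fixed `ε`, and the main theorem. -/

section Main

theorem IsVelocityFamily.exists_norm_le {β : ℝ} {u : ℝ → ℝ → (ℝ × ℝ →ᵇ ℝ)}
    (hu : IsVelocityFamily β u) :
    ∃ M : ℝ, ∀ ε ∈ Ioo (0 : ℝ) 1, ∀ t : ℝ, 0 ≤ t → ‖u ε t‖ ≤ M := by
  obtain ⟨M, hM⟩ := hu.bounded
  exact ⟨max M 0, fun ε hε t ht => (BoundedContinuousFunction.norm_le (le_max_right _ _)).2
    fun p => (hM ε hε t ht p).trans (le_max_left _ _)⟩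

theorem IsVelocityFamily.exists_lipschitz {β : ℝ} {u : ℝ → ℝ → (ℝ × ℝ →ᵇ ℝ)}
    (hu : IsVelocityFamily β u) {δ : ℝ} (hδ : 0 < δ) :
    ∃ c : ℝ, 0 ≤ c ∧ ∀ ε ∈ Ioo (0 : ℝ) 1, ∀ t ∈ Icc 0 δ, ∀ p q : ℝ × ℝ,
      |u ε t q - u ε t p| ≤ c / ε ^ β * ‖p - q‖ := by
  obtain ⟨c, hc⟩ := hu.gradient_bound δ hδ
  refine ⟨2 * |c|, by positivity, fun ε hε t ht p q => ?_⟩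
  have hεβ : 0 < ε ^ β := Real.rpow_pos_of_pos hε.1 β
  refine (abs_sub_le_of_partial_bound (hu.differentiable ε hε t ht.1) (hc ε hε t ht) p q).trans ?_
  rw [mul_div_assoc]
  gcongr
  exact le_abs_self c

theorem hasDerivWithinAt_apply {X : ℝ → (ℝ × ℝ →ᵇ ℝ)} {D : ℝ × ℝ →ᵇ ℝ} {s : Set ℝ} {t : ℝ}
    (h : HasDerivWithinAt X D s t) (p : ℝ × ℝ) : HasDerivWithinAt (fun r => X r p) (D p) s t := by
  have := (BoundedContinuousFunction.evalCLM ℝ p).hasFDerivAt.comp_hasDerivWithinAt t h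
  exact this

/-- The upwind estimate is used with `L` the identity and `κ = 1`; the pressure terms cancel, so no
power of `r` enters the bound. -/
theorem IsTestFunction.exists_momentum_bound {ψ : ℝ × ℝ → ℝ} (hψ : IsTestFunction ψ)
    (P Q : Polynomial ℝ) :
    ∃ C : ℝ, 0 ≤ C ∧ ∀ M ε : ℝ, 0 < ε → ε ≤ 1 → ∀ u v W b : ℝ × ℝ →ᵇ ℝ, ‖u‖ ≤ M → ‖v‖ ≤ M →
      IsTorusPeriodic u → IsTorusPeriodic v → IsTorusPeriodic W → ∀ r : ℝ × ℝ → ℝ,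
      ContDiff ℝ ∞ r → (∀ p, b p = -(P.derivative.eval (r p) * partialX r p) -
        Q.derivative.eval (r p) * partialY r p) →
      |∫ p, ((upwindCLM ε u v W + b) p * ψ p - (u p * W p + P.eval (r p)) * partialX ψ p -
        (v p * W p + Q.eval (r p)) * partialY ψ p)| ≤ C * M * torusL1 W * ε := by
  obtain ⟨C, hC0, hC⟩ := hψ.exists_upwind_bound
  refine ⟨C, hC0, fun M ε hε hε1 u v W b hu hv hpu hpv hpW r hr hb => ?_⟩
  have h := hC M 1 ε (ContinuousLinearMap.id ℝ _) zero_le_one (fun _ _ => rfl)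
    (fun f hf => ⟨hf, by rw [one_mul]; rfl⟩) hε hε1 u v W hu hv hpu hpv hpW
  rw [mul_one] at h
  refine le_trans (le_of_eq (congrArg _ ?_)) h
  have hψc := hψ.1.continuous
  have hψx := hψ.continuous_partialX
  have hψy := hψ.continuous_partialY
  have hrc := hr.continuous
  have hrd : Differentiable ℝ r := hr.differentiable (by simp)
  have hrx : Continuous fun p => fderiv ℝ r p (1, 0) :=
    (hr.continuous_fderiv (by simp)).clm_apply continuous_const
  have hry : Continuous fun p => fderiv ℝ r p (0, 1) :=
    (hr.continuous_fderiv (by simp)).clm_apply continuous_const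
  have hev : ∀ A : Polynomial ℝ, Continuous fun p => A.eval (r p) := fun A => A.continuous.comp hrc
  have hP := hev P
  have hQ := hev Q
  have hP' := hev P.derivative
  have hQ' := hev Q.derivative
  have iψ : ∀ {F : ℝ × ℝ → ℝ}, Continuous F → Integrable fun p => F p * ψ p := fun hF =>
    (hF.mul hψc).integrable_of_hasCompactSupport hψ.2.mul_left
  have ix : ∀ {F : ℝ × ℝ → ℝ}, Continuous F → Integrable fun p => F p * partialX ψ p := fun hF =>
    (hF.mul hψx).integrable_of_hasCompactSupport hψ.hasCompactSupport_partialX.mul_left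
  have iy : ∀ {F : ℝ × ℝ → ℝ}, Continuous F → Integrable fun p => F p * partialY ψ p := fun hF =>
    (hF.mul hψy).integrable_of_hasCompactSupport hψ.hasCompactSupport_partialY.mul_left
  have ePx := integral_eval_derivative_mul P hr hψ (1, 0)
  have eQy := integral_eval_derivative_mul Q hr hψ (0, 1)
  simp only [← (hrd _).partialX_eq, ← (hrd _).partialY_eq, ← (hψ.differentiable _).partialX_eq,
    ← (hψ.differentiable _).partialY_eq] at ePx eQy hrx hry
  have j1 : Integrable fun p => P.derivative.eval (r p) * partialX r p * ψ p := iψ (by fun_prop)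
  have j2 : Integrable fun p => Q.derivative.eval (r p) * partialY r p * ψ p := iψ (by fun_prop)
  have j3 : Integrable fun p => P.eval (r p) * partialX ψ p := ix hP
  have j4 : Integrable fun p => Q.eval (r p) * partialY ψ p := iy hQ
  have j0 : Integrable fun p => upwindCLM ε u v W p * ψ p - (W * u) p * partialX ψ p -
      (W * v) p * partialY ψ p :=
    ((iψ (by fun_prop)).sub (ix (by fun_prop))).sub (iy (by fun_prop))
  have j5 : Integrable fun p => P.derivative.eval (r p) * partialX r p * ψ p +
    P.eval (r p) * partialX ψ p := j1.add j3
  have j6 : Integrable fun p => Q.derivative.eval (r p) * partialY r p * ψ p +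
    Q.eval (r p) * partialY ψ p := j2.add j4
  have hsplit : ∫ p, ((upwindCLM ε u v W + b) p * ψ p -
      (u p * W p + P.eval (r p)) * partialX ψ p - (v p * W p + Q.eval (r p)) * partialY ψ p) =
      (∫ p, (upwindCLM ε u v W p * ψ p - (W * u) p * partialX ψ p - (W * v) p * partialY ψ p)) -
        (∫ p, (P.derivative.eval (r p) * partialX r p * ψ p + P.eval (r p) * partialX ψ p)) -
        ∫ p, (Q.derivative.eval (r p) * partialY r p * ψ p + Q.eval (r p) * partialY ψ p) := by
    have j7 := j0.sub j5
    simp only [Pi.sub_def] at j7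
    rw [← integral_sub j0 j5, ← integral_sub j7 j6]
    congr 1
    ext p
    simp only [BoundedContinuousFunction.coe_add, BoundedContinuousFunction.coe_mul, Pi.add_apply,
      Pi.mul_apply, hb]
    ring
  rw [hsplit, integral_add j1 j3, integral_add j2 j4, ePx, eQy, add_neg_cancel, add_neg_cancel,
    sub_zero, sub_zero]
  rfl

/-- The equation for `w`, for a fixed step: solvability, periodicity and the `L¹` bound. -/
theorem exists_momentum_solution (P Q : Polynomial ℝ) {φ : ℝ × ℝ → ℝ} (hφ : IsTestFunction φ)
    {ε h : ℝ} (hε : 0 < ε) (hh : 0 < h) {u v : ℝ → (ℝ × ℝ →ᵇ ℝ)}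
    (hu : ContinuousOn u (Ici 0)) (hv : ContinuousOn v (Ici 0)) {M : ℝ}
    (hMu : ∀ t, 0 ≤ t → ‖u t‖ ≤ M) (hMv : ∀ t, 0 ≤ t → ‖v t‖ ≤ M)
    (hpu : ∀ t, 0 ≤ t → IsTorusPeriodic (u t)) (hpv : ∀ t, 0 ≤ t → IsTorusPeriodic (v t))
    {X : ℝ → (ℝ × ℝ →ᵇ ℝ)} (hX : ContinuousOn X (Ici 0))
    (hpX : ∀ t, 0 ≤ t → IsTorusPeriodic (X t)) {B : ℝ}
    (hB : ∀ t, 0 ≤ t → ∀ r rx ry : ℝ × ℝ →ᵇ ℝ,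
      (∀ p, r p = planeConv (X t) (scaledKernel φ h) p) →
      (∀ p, rx p = partialX (planeConv (X t) (scaledKernel φ h)) p) →
      (∀ p, ry p = partialY (planeConv (X t) (scaledKernel φ h)) p) →
      ‖pressureBCF P Q r rx ry‖ ≤ B)
    {w₀ : ℝ × ℝ →ᵇ ℝ} (hp0 : IsTorusPeriodic w₀) :
    ∃ w : ℝ → (ℝ × ℝ →ᵇ ℝ),
      IsUniqueUpwindSolution ε u v
        (pressureSource P Q fun t => planeConv (X t) (scaledKernel φ h)) w₀ w ∧
      (∀ t, 0 ≤ t → IsTorusPeriodic (w t)) ∧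
      (∀ t, 0 ≤ t → torusL1 (w t) ≤ torusL1 w₀ + (2 * Real.pi) ^ 2 * B * t) ∧
      ∀ t, 0 ≤ t → ∃ b : ℝ × ℝ →ᵇ ℝ,
        (∀ p, b p = pressureSource P Q (fun t => planeConv (X t) (scaledKernel φ h)) t p) ∧
        HasDerivWithinAt w (upwindCLM ε (u t) (v t) (w t) + b) (Ici 0) t := by
  have hk := isTestFunction_scaledKernel hφ hh
  set L := convCLM _ hk.1.continuous hk.2
  -- With the derivatives on the kernel, the mollification of `X t` and its partial derivatives are
  -- images of `X t` under bounded operators, so the source is continuous in time for the sup norm.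
  set Lx := convCLM _ hk.continuous_partialX hk.hasCompactSupport_partialX
  set Ly := convCLM _ hk.continuous_partialY hk.hasCompactSupport_partialY
  have hLx : ∀ f p, Lx f p = partialX (planeConv f (scaledKernel φ h)) p := fun f p =>
    (partialX_planeConv f.continuous hk p).symm
  have hLy : ∀ f p, Ly f p = partialY (planeConv f (scaledKernel φ h)) p := fun f p =>
    (partialY_planeConv f.continuous hk p).symm
  set b : ℝ → (ℝ × ℝ →ᵇ ℝ) := fun t => pressureBCF P Q (L (X t)) (Lx (X t)) (Ly (X t))
  have hbS : ∀ t, 0 ≤ t → ∀ p,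
      pressureSource P Q (fun t => planeConv (X t) (scaledKernel φ h)) t p = b t p := by
    intro t _ p
    simp only [b, pressureBCF_apply, hLx, hLy]
    rfl
  have hbB : ∀ t, 0 ≤ t → ‖b t‖ ≤ B := fun t ht =>
    hB t ht _ _ _ (fun _ => rfl) (hLx _) (hLy _)
  obtain ⟨w, hw, hpw⟩ := exists_isUniqueUpwindSolution hε hu hv hMu hMv hpu hpv (b := b)
    (continuousOn_pressureBCF P Q (L.continuous.comp_continuousOn hX)
      (Lx.continuous.comp_continuousOn hX) (Ly.continuous.comp_continuousOn hX)) hbB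
    (fun t ht => isTorusPeriodic_pressureBCF P Q ((hpX t ht).planeConv _)
      ((hpX t ht).planeConv _) ((hpX t ht).planeConv _)) hp0
  have hsol := hw _ hbS
  obtain ⟨hw0, hwd⟩ := (isUpwindSolution_iff hbS).1 hsol.1
  refine ⟨w, hsol, hpw, fun t ht => ?_, fun t ht => ⟨b t, fun p => (hbS t ht p).symm, hwd t ht⟩⟩
  rw [← hw0]
  exact torusL1_solution_le hε hMu hMv hpu hpv hbB hpw hwd ht

/-- The equation for `X`, for a fixed step: solvability, periodicity and the `L¹` bound. -/
theorem exists_density_solution {ε : ℝ} (hε : 0 < ε) {u v : ℝ → (ℝ × ℝ →ᵇ ℝ)}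
    (hu : ContinuousOn u (Ici 0)) (hv : ContinuousOn v (Ici 0)) {M : ℝ}
    (hMu : ∀ t, 0 ≤ t → ‖u t‖ ≤ M) (hMv : ∀ t, 0 ≤ t → ‖v t‖ ≤ M)
    (hpu : ∀ t, 0 ≤ t → IsTorusPeriodic (u t)) (hpv : ∀ t, 0 ≤ t → IsTorusPeriodic (v t))
    {X₀ : ℝ × ℝ →ᵇ ℝ} (hp0 : IsTorusPeriodic X₀) :
    ∃ X : ℝ → (ℝ × ℝ →ᵇ ℝ), IsUniqueUpwindSolution ε u v (fun _ _ => 0) X₀ X ∧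
      (∀ t, 0 ≤ t → IsTorusPeriodic (X t)) ∧ (∀ t, 0 ≤ t → torusL1 (X t) ≤ torusL1 X₀) ∧
      ∀ t, 0 ≤ t → HasDerivWithinAt X (upwindCLM ε (u t) (v t) (X t)) (Ici 0) t := by
  obtain ⟨X, hX, hpX⟩ := exists_isUniqueUpwindSolution hε hu hv hMu hMv hpu hpv
    (b := fun _ => 0) continuousOn_const (B := 0) (fun _ _ => by simp)
    (fun _ _ _ _ => ⟨rfl, rfl⟩) hp0
  have hsol := hX (fun _ _ => 0) fun _ _ _ => rfl
  obtain ⟨hX0, hXd⟩ := (isUpwindSolution_iff (b := fun _ => 0) fun _ _ _ => rfl).1 hsol.1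
  refine ⟨X, hsol, hpX, fun t ht => ?_, fun t ht => by simpa using hXd t ht⟩
  have h := torusL1_solution_le hε hMu hMv hpu hpv (B := 0) (fun _ _ => by simp) hpX hXd ht
  rw [hX0] at h
  simpa using h

/-- The origin of `N`: `d` factors of size `y⁻²` from the density and one of size `y⁻³` from its
gradient. -/
theorem mul_div_pow_mul_div (c K : ℝ) {y : ℝ} (hy : y ≠ 0) (d : ℕ) :
    c * (K / y ^ 2) ^ d * (K / y ^ 3) = c * K ^ (d + 1) / y ^ (2 * d + 3) := by
  rw [div_pow, ← pow_mul, pow_succ, pow_add]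
  field_simp
  ring

theorem attainsInitialData_of_eq {f : ℝ → (ℝ × ℝ →ᵇ ℝ)} (hf : IsInitialFamily f)
    {q : ℝ → ℝ → ℝ × ℝ → ℝ} (hq : ∀ ε ∈ Ioo (0 : ℝ) 1, q ε 0 = f ε) :
    AttainsInitialData f q := by
  intro f₀ hp0 hl0 hlim ψ hψ
  obtain ⟨C, hC0, hC⟩ := hψ.exists_integral_sub_bound
  rw [tendsto_iff_dist_tendsto_zero]
  refine squeeze_zero' (Eventually.of_forall fun _ => dist_nonneg) ?_
    (by simpa using hlim.const_mul C)
  filter_upwards [Ioo_mem_nhdsGT (zero_lt_one (α := ℝ))] with ε hε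
  rw [Real.dist_eq, hq ε hε]
  exact hC _ _ (hf.periodic ε hε) hp0 (f ε).continuous.locallyIntegrable hl0

theorem attainsInitialData_mollified {f : ℝ → (ℝ × ℝ →ᵇ ℝ)} (hf : IsInitialFamily f)
    {φ : ℝ × ℝ → ℝ} (hφ : IsTestFunction φ) (hφ1 : ∫ p, φ p = 1) {α : ℝ} (hα : 0 < α)
    {X : ℝ → ℝ → (ℝ × ℝ →ᵇ ℝ)} (hX : ∀ ε ∈ Ioo (0 : ℝ) 1, X ε 0 = f ε) :
    AttainsInitialData f (mollified φ α X) := by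
  intro f₀ hp0 hl0 hlim ψ hψ
  -- The unmollified data already converge weakly; it remains to see that mollification changes the
  -- pairing by `O(ε ^ α)`.
  have h1 := attainsInitialData_of_eq hf (q := fun ε _ => f ε) (fun _ _ => rfl) f₀ hp0 hl0 hlim ψ hψ
  obtain ⟨C, hC0, hC⟩ := hψ.exists_mollification_consistency hφ.1.continuous hφ.2 hφ1
  obtain ⟨B, hB⟩ := hf.bounded
  refine h1.congr_dist (squeeze_zero' (Eventually.of_forall fun _ => dist_nonneg) ?_
    (by simpa using (tendsto_rpow_nhdsGT_zero hα).const_mul (C * B)))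
  filter_upwards [Ioo_mem_nhdsGT (zero_lt_one (α := ℝ))] with ε hε
  rw [dist_comm, Real.dist_eq]
  have hh : 0 < ε ^ α := Real.rpow_pos_of_pos hε.1 α
  have h2 := hC (ε ^ α) hh (Real.rpow_le_one hε.1.le hε.2.le hα.le) (f ε) (hf.periodic ε hε)
    (f ε).continuous
  simp only [mollified, hX ε hε]
  refine h2.trans ?_
  gcongr
  exact hB ε hε

end Main

theorem mainTheorem6 (P Q : Polynomial ℝ) :
    ∃ N : ℕ, ∀ (α β : ℝ), 0 < α → α ≤ 1 → 0 < β → β < α →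
      ∀ φ : ℝ × ℝ → ℝ, IsTestFunction φ → (∫ p, φ p) = 1 →
      ∀ u v : ℝ → ℝ → (ℝ × ℝ →ᵇ ℝ), IsVelocityFamily β u → IsVelocityFamily β v →
      ∀ ρ₀ w₀ : ℝ → (ℝ × ℝ →ᵇ ℝ), IsInitialFamily ρ₀ → IsInitialFamily w₀ →
      ∃ X w : ℝ → ℝ → (ℝ × ℝ →ᵇ ℝ),
        -- the two ODEs have unique global solutions, which are periodic
        (∀ ε ∈ Set.Ioo (0 : ℝ) 1,
          IsUniqueUpwindSolution ε (u ε) (v ε) (fun _ _ => 0) (ρ₀ ε) (X ε) ∧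
          IsUniqueUpwindSolution ε (u ε) (v ε)
            (pressureSource P Q (mollified φ α X ε)) (w₀ ε) (w ε) ∧
          ∀ t : ℝ, 0 ≤ t → IsTorusPeriodic (X ε t) ∧ IsTorusPeriodic (w ε t)) ∧
        -- the `L¹` bound for `X`
        (∃ C : ℝ, ∀ ε ∈ Set.Ioo (0 : ℝ) 1, ∀ t : ℝ, 0 ≤ t →
          torusL1 (X ε t) ≤ torusL1 (ρ₀ ε) ∧ torusL1 (ρ₀ ε) ≤ C) ∧
        -- the pointwise bounds for `ρ` and its first derivatives
        (∃ M : ℝ, ∀ ε ∈ Set.Ioo (0 : ℝ) 1, ∀ t : ℝ, 0 ≤ t →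
          ContDiff ℝ ∞ (mollified φ α X ε t) ∧ ∀ p : ℝ × ℝ,
            |mollified φ α X ε t p| ≤ M / ε ^ (2 * α) ∧
            |partialX (mollified φ α X ε t) p| ≤ M / ε ^ (3 * α) ∧
            |partialY (mollified φ α X ε t) p| ≤ M / ε ^ (3 * α)) ∧
        -- the `L¹` bound for `w`
        (∃ C : ℝ, 0 < C ∧ ∀ ε ∈ Set.Ioo (0 : ℝ) 1, ∀ t : ℝ, 0 ≤ t →
          torusL1 (w ε t) ≤ C * (1 + t) / ε ^ ((N : ℝ) * α)) ∧
        -- the continuity equation for `ρ`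
        IsWeakAsymptoticMethod (mollified φ α X)
          (fun ε t p => u ε t p * mollified φ α X ε t p)
          (fun ε t p => v ε t p * mollified φ α X ε t p) ∧
        AttainsInitialData ρ₀ (mollified φ α X) ∧
        -- the equation for `w`
        ((N : ℝ) * α < 1 →
          IsWeakAsymptoticMethod (fun ε t p => w ε t p)
            (fun ε t p => u ε t p * w ε t p + P.eval (mollified φ α X ε t p))
            (fun ε t p => v ε t p * w ε t p + Q.eval (mollified φ α X ε t p))) ∧
        AttainsInitialData w₀ (fun ε t p => w ε t p) := by
  set d := P.derivative.natDegree + Q.derivative.natDegree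
  refine ⟨2 * d + 3, ?_⟩
  intro α β hα _ _ hβα φ hφ hφ1 u v hu hv ρ₀ w₀ hρ hw₀
  obtain ⟨Mu, hMu⟩ := hu.exists_norm_le
  obtain ⟨Mv, hMv⟩ := hv.exists_norm_le
  set M := max Mu Mv
  replace hMu : ∀ ε ∈ Ioo (0 : ℝ) 1, ∀ t, 0 ≤ t → ‖u ε t‖ ≤ M := fun ε hε t ht =>
    (hMu ε hε t ht).trans (le_max_left _ _)
  replace hMv : ∀ ε ∈ Ioo (0 : ℝ) 1, ∀ t, 0 ≤ t → ‖v ε t‖ ≤ M := fun ε hε t ht =>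
    (hMv ε hε t ht).trans (le_max_right _ _)
  have hhalf : (1 / 2 : ℝ) ∈ Ioo (0 : ℝ) 1 := by constructor <;> norm_num
  have hM0 : 0 ≤ M := (norm_nonneg _).trans (hMu _ hhalf 0 le_rfl)
  obtain ⟨Cρ, hCρ⟩ := hρ.bounded
  obtain ⟨Cw, hCw⟩ := hw₀.bounded
  have hCρ0 : 0 ≤ Cρ := (torusL1_nonneg _).trans (hCρ _ hhalf)
  have hCw0 : 0 ≤ Cw := (torusL1_nonneg _).trans (hCw _ hhalf)
  -- Stated for every real `ε`, with the junk value `0` outside `(0, 1)`, so that one family can be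
  -- chosen.
  have hXex : ∀ ε : ℝ, ∃ X : ℝ → (ℝ × ℝ →ᵇ ℝ), ε ∈ Ioo (0 : ℝ) 1 →
      IsUniqueUpwindSolution ε (u ε) (v ε) (fun _ _ => 0) (ρ₀ ε) X ∧
      (∀ t, 0 ≤ t → IsTorusPeriodic (X t)) ∧ (∀ t, 0 ≤ t → torusL1 (X t) ≤ torusL1 (ρ₀ ε)) ∧
      ∀ t, 0 ≤ t → HasDerivWithinAt X (upwindCLM ε (u ε t) (v ε t) (X t)) (Ici 0) t := fun ε => by
    by_cases hε : ε ∈ Ioo (0 : ℝ) 1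
    · obtain ⟨X, hX⟩ := exists_density_solution hε.1 (hu.continuous_time ε hε)
        (hv.continuous_time ε hε) (hMu ε hε) (hMv ε hε) (hu.periodic ε hε) (hv.periodic ε hε)
        (hρ.periodic ε hε)
      exact ⟨X, fun _ => hX⟩
    · exact ⟨0, fun h => absurd h hε⟩
  choose X hX using hXex
  have hh : ∀ ε ∈ Ioo (0 : ℝ) 1, 0 < ε ^ α := fun ε hε => Real.rpow_pos_of_pos hε.1 α
  have hh1 : ∀ ε ∈ Ioo (0 : ℝ) 1, ε ^ α ≤ 1 := fun ε hε =>
    Real.rpow_le_one hε.1.le hε.2.le hα.le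
  have hpow : ∀ ε ∈ Ioo (0 : ℝ) 1, ∀ n : ℕ, ε ^ ((n : ℝ) * α) = (ε ^ α) ^ n := fun ε hε n => by
    rw [mul_comm, Real.rpow_mul hε.1.le, Real.rpow_natCast]
  obtain ⟨Cm, hCm0, hCm⟩ := exists_mollification_bounds hφ
  -- The added `1` gives `K ≥ 1`, hence `K / (ε ^ α) ^ 2 ≥ 1`, as the polynomial bound requires.
  set K := Cm * Cρ + 1
  have hK0 : 1 ≤ K := by
    have : 0 ≤ Cm * Cρ := by positivity
    linarith
  have hbd : ∀ ε ∈ Ioo (0 : ℝ) 1, ∀ t, 0 ≤ t → ∀ p,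
      |mollified φ α X ε t p| ≤ K / (ε ^ α) ^ 2 ∧
      |partialX (mollified φ α X ε t) p| ≤ K / (ε ^ α) ^ 3 ∧
      |partialY (mollified φ α X ε t) p| ≤ K / (ε ^ α) ^ 3 := by
    intro ε hε t ht p
    have h0 := hh ε hε
    have h1 := hCm (ε ^ α) h0 (hh1 ε hε) (X ε t) ((hX ε hε).2.1 t ht) (X ε t).continuous p
    have h2 : Cm * torusL1 (X ε t) ≤ K := by
      have := mul_le_mul_of_nonneg_left (((hX ε hε).2.2.1 t ht).trans (hCρ ε hε)) hCm0
      linarith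
    exact ⟨h1.1.trans (by gcongr), h1.2.1.trans (by gcongr), h1.2.2.trans (by gcongr)⟩
  obtain ⟨cp, hcp0, hcp⟩ := exists_pressure_bound P Q
  set B := cp * K ^ (d + 1)
  have hB0 : 0 ≤ B := by positivity
  have hwex : ∀ ε : ℝ, ∃ w : ℝ → (ℝ × ℝ →ᵇ ℝ), ε ∈ Ioo (0 : ℝ) 1 →
      IsUniqueUpwindSolution ε (u ε) (v ε) (pressureSource P Q (mollified φ α X ε)) (w₀ ε) w ∧
      (∀ t, 0 ≤ t → IsTorusPeriodic (w t)) ∧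
      (∀ t, 0 ≤ t → torusL1 (w t) ≤ torusL1 (w₀ ε) +
        (2 * Real.pi) ^ 2 * (B / (ε ^ α) ^ (2 * d + 3)) * t) ∧
      ∀ t, 0 ≤ t → ∃ b : ℝ × ℝ →ᵇ ℝ,
        (∀ p, b p = pressureSource P Q (mollified φ α X ε) t p) ∧
        HasDerivWithinAt w (upwindCLM ε (u ε t) (v ε t) (w t) + b) (Ici 0) t := fun ε => by
    by_cases hε : ε ∈ Ioo (0 : ℝ) 1
    · have h0 := hh ε hε
      obtain ⟨w, hw⟩ := exists_momentum_solution P Q hφ hε.1 h0 (hu.continuous_time ε hε)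
        (hv.continuous_time ε hε) (hMu ε hε) (hMv ε hε) (hu.periodic ε hε) (hv.periodic ε hε)
        (fun t ht => ((hX ε hε).2.2.2 t ht).continuousWithinAt) (hX ε hε).2.1
        (B := B / (ε ^ α) ^ (2 * d + 3)) (fun t ht r rx ry hr hrx hry => by
          have hR : 1 ≤ K / (ε ^ α) ^ 2 :=
            hK0.trans (le_div_self (by linarith) (by positivity) (pow_le_one₀ h0.le (hh1 ε hε)))
          refine (hcp _ (K / (ε ^ α) ^ 3) hR r rx ry fun p => ?_).trans (le_of_eq ?_)
          · rw [hr, hrx, hry]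
            exact hbd ε hε t ht p
          · exact mul_div_pow_mul_div cp K h0.ne' d) (hw₀.periodic ε hε)
      exact ⟨w, fun _ => hw⟩
    · exact ⟨0, fun h => absurd h hε⟩
  choose w hw using hwex
  set Cb := Cw + (2 * Real.pi) ^ 2 * B + 1
  have hCb0 : 0 < Cb := by positivity
  have hwL : ∀ ε ∈ Ioo (0 : ℝ) 1, ∀ t, 0 ≤ t →
      torusL1 (w ε t) ≤ Cb * (1 + t) / (ε ^ α) ^ (2 * d + 3) := by
    intro ε hε t ht
    have h0 := hh ε hε
    set y := (ε ^ α) ^ (2 * d + 3)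
    have hy : 0 < y := by positivity
    have hy1 : y ≤ 1 := pow_le_one₀ h0.le (hh1 ε hε)
    refine ((hw ε hε).2.2.1 t ht).trans ?_
    rw [le_div_iff₀ hy, add_mul]
    have h1 : torusL1 (w₀ ε) * y ≤ Cw :=
      (mul_le_of_le_one_right (torusL1_nonneg _) hy1).trans (hCw ε hε)
    have h2 : (2 * Real.pi) ^ 2 * (B / y) * t * y = (2 * Real.pi) ^ 2 * B * t := by
      field_simp
    rw [h2]
    have h3 : 0 ≤ (2 * Real.pi) ^ 2 * B := by positivity
    have h4 : 0 ≤ Cw * t := by positivity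
    simp only [Cb]
    nlinarith
  have hρc : ∀ ε ∈ Ioo (0 : ℝ) 1, ∀ t, ContDiff ℝ ∞ (mollified φ α X ε t) := fun ε hε t =>
    contDiff_planeConv (X ε t).continuous (isTestFunction_scaledKernel hφ (hh ε hε))
  refine ⟨X, w, fun ε hε => ⟨(hX ε hε).1, (hw ε hε).1, fun t ht =>
    ⟨(hX ε hε).2.1 t ht, (hw ε hε).2.1 t ht⟩⟩,
    ⟨Cρ, fun ε hε t ht => ⟨(hX ε hε).2.2.1 t ht, hCρ ε hε⟩⟩,
    ⟨K, fun ε hε t ht => ⟨hρc ε hε t, fun p => ?_⟩⟩,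
    ⟨Cb, hCb0, fun ε hε t ht => ?_⟩, ?_,
    attainsInitialData_mollified hρ hφ hφ1 hα fun ε hε => (hX ε hε).1.1.1, fun hN => ?_,
    attainsInitialData_of_eq hw₀ fun ε hε => by rw [(hw ε hε).1.1.1]⟩
  · have e2 := hpow ε hε 2
    have e3 := hpow ε hε 3
    push_cast at e2 e3
    rw [e2, e3]
    exact hbd ε hε t ht p
  · rw [hpow ε hε]
    exact hwL ε hε t ht
  · refine isWeakAsymptoticMethod_of_bound
      (D := fun ε t => planeConv (upwindCLM ε (u ε t) (v ε t) (X ε t)) (scaledKernel φ (ε ^ α)))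
      (fun ε hε t ht p => ?_) (fun ε hε t ht => ?_) fun ψ hψ δ hδ => ?_
    · set L := convCLM (scaledKernel φ (ε ^ α)) (continuous_scaledKernel hφ.1.continuous _)
          (hasCompactSupport_scaledKernel hφ.2 (hh ε hε))
      exact hasDerivWithinAt_apply
        (L.hasFDerivAt.comp_hasDerivWithinAt t ((hX ε hε).2.2.2 t ht)) p
    · have h1 := (hρc ε hε t).continuous
      exact ⟨continuous_planeConv (BoundedContinuousFunction.continuous _)
        (continuous_scaledKernel hφ.1.continuous _) (hasCompactSupport_scaledKernel hφ.2 (hh ε hε)),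
        (u ε t).continuous.mul h1, (v ε t).continuous.mul h1⟩
    · obtain ⟨C, hC0, hC⟩ := hψ.exists_continuity_bound hφ.1.continuous hφ.2
      obtain ⟨cu, hcu0, hcu⟩ := hu.exists_lipschitz hδ
      obtain ⟨cv, hcv0, hcv⟩ := hv.exists_lipschitz hδ
      -- With the common Lipschitz constant `(cu + cv) / ε ^ β` the commutator error is of order `ε
      -- ^ (α - β)`, which tends to zero because `β < α`.
      refine ⟨fun ε => C * Cρ * (M * ε ^ (1 : ℝ) + (cu + cv) * ε ^ (α - β)), ?_,
        fun ε hε t ht => ?_⟩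
      · have h1 := (tendsto_rpow_nhdsGT_zero one_pos).const_mul M
        have h2 := (tendsto_rpow_nhdsGT_zero (sub_pos.2 hβα)).const_mul (cu + cv)
        simpa using (h1.add h2).const_mul (C * Cρ)
      · have hεβ : 0 < ε ^ β := Real.rpow_pos_of_pos hε.1 β
        have h0 := hh ε hε
        refine (hC M ((cu + cv) / ε ^ β) ε (ε ^ α) h0 hε.1 hε.2.le (by positivity) (u ε t) (v ε t)
          (X ε t) (hMu ε hε t ht.1) (hMv ε hε t ht.1) (hu.periodic ε hε t ht.1)
          (hv.periodic ε hε t ht.1) ((hX ε hε).2.1 t ht.1)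
          (fun p q => (hcu ε hε t ht p q).trans (by gcongr; linarith))
          (fun p q => (hcv ε hε t ht p q).trans (by gcongr; linarith))).trans ?_
        have h1 : (cu + cv) / ε ^ β * ε ^ α = (cu + cv) * ε ^ (α - β) := by
          rw [Real.rpow_sub hε.1]
          ring
        have h2 : 0 < ε ^ (α - β) := Real.rpow_pos_of_pos hε.1 _
        have h3 := hε.1
        simp only [h1, Real.rpow_one]
        gcongr
        exact ((hX ε hε).2.2.1 t ht.1).trans (hCρ ε hε)
  -- The bounded continuous source `b` exists separately for each `ε` and `t`; writing the time
  -- derivative through `upwind` and `pressureSource` gives a formula free of that choice.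
  · have hwd : ∀ ε ∈ Ioo (0 : ℝ) 1, ∀ t, 0 ≤ t → ∃ b : ℝ × ℝ →ᵇ ℝ,
        (∀ p, b p = pressureSource P Q (mollified φ α X ε) t p) ∧
        (fun p => upwind ε (u ε t) (v ε t) (w ε t) p +
          pressureSource P Q (mollified φ α X ε) t p) =
          ⇑(upwindCLM ε (u ε t) (v ε t) (w ε t) + b) ∧
        HasDerivWithinAt (w ε) (upwindCLM ε (u ε t) (v ε t) (w ε t) + b) (Ici 0) t := by
      intro ε hε t ht
      obtain ⟨b, hb, hb'⟩ := (hw ε hε).2.2.2 t ht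
      refine ⟨b, hb, funext fun p => ?_, hb'⟩
      rw [BoundedContinuousFunction.add_apply, hb, upwindCLM_eq_upwind]
    refine isWeakAsymptoticMethod_of_bound
      (D := fun ε t p => upwind ε (u ε t) (v ε t) (w ε t) p +
        pressureSource P Q (mollified φ α X ε) t p)
      (fun ε hε t ht p => ?_) (fun ε hε t ht => ?_) fun ψ hψ δ hδ => ?_
    · obtain ⟨b, -, hb, hb'⟩ := hwd ε hε t ht
      have h1 := hasDerivWithinAt_apply hb' p
      rwa [← hb] at h1
    · obtain ⟨b, -, hb, -⟩ := hwd ε hε t ht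
      have h1 := (hρc ε hε t).continuous
      simp only [hb]
      exact ⟨BoundedContinuousFunction.continuous _,
        ((u ε t).continuous.mul (w ε t).continuous).add (P.continuous.comp h1),
        ((v ε t).continuous.mul (w ε t).continuous).add (Q.continuous.comp h1)⟩
    · obtain ⟨C, hC0, hC⟩ := hψ.exists_momentum_bound P Q
      -- The consistency error `ε` meets the growth `ε ^ (-N α)` of the `L¹` norm of `w`; the
      -- exponent `1 - N α` is positive by `hN`.
      refine ⟨fun ε => C * M * (Cb * (1 + δ)) * ε ^ (1 - ((2 * d + 3 : ℕ) : ℝ) * α), ?_,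
        fun ε hε t ht => ?_⟩
      · simpa using (tendsto_rpow_nhdsGT_zero (sub_pos.2 hN)).const_mul (C * M * (Cb * (1 + δ)))
      · obtain ⟨b, hbs, hb, -⟩ := hwd ε hε t ht.1
        have h1 := hC M ε hε.1 hε.2.le (u ε t) (v ε t) (w ε t) b (hMu ε hε t ht.1)
          (hMv ε hε t ht.1) (hu.periodic ε hε t ht.1) (hv.periodic ε hε t ht.1)
          ((hw ε hε).2.1 t ht.1) _ (hρc ε hε t) hbs
        rw [← hb] at h1
        refine h1.trans ?_
        have h0 := hh ε hε
        have h2 := hwL ε hε t ht.1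
        simp only [Real.rpow_sub hε.1, Real.rpow_one, hpow ε hε]
        calc C * M * torusL1 (w ε t) * ε
            ≤ C * M * (Cb * (1 + δ) / (ε ^ α) ^ (2 * d + 3)) * ε := by
              have h3 := hε.1.le
              gcongr
              refine h2.trans ?_
              gcongr
              exact ht.2
          _ = _ := by ring
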